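/- Let $\mathcal C$ be an $\infty$-category (a quasicategory), let $K$ be a simplicial set and let $p\colon K\to\mathcal C$ be a map of simplicial sets. Let $\star$ denote the join of simplicial sets, so that a map $X\to A\star B$ is the same as a triple consisting of a map $X\to\Delta^1$ together with maps $X_0\to A$ and $X_1\to B$, where $X_i=\{i\}\times_{\Delta^1}X$. Put $K^\triangleleft=\Delta^0\star K$. Let $\mathcal C_{/p}$ be the slice, whose $n$-simplices are the maps $\Delta^n\star K\to\mathcal C$ that restrict to $p$ on $K$, and let $\mathcal C^{K^\triangleleft}\times_{\mathcal C^K}\{p\}$ be the fiber over $p$ of the restriction map $\mathcal C^{K^\triangleleft}\to\mathcal C^K$ between simplicial sets of maps. For every simplicial set $W$, let $W\times K^\triangleleft\to W\star K$ be the map corresponding to the triple consisting of the composite $W\times K^\triangleleft\to K^\triangleleft\to\Delta^1$ and the projections $W\times\Delta^0\cong W$ and $W\times K\to K$. Composing a map $\Delta^n\star K\to\mathcal C$ that restricts to $p$ on $K$ with the map $\Delta^n\times K^\triangleleft\to\Delta^n\star K$ defines a canonical map of simplicial sets $$\varphi\colon\ \mathcal C_{/p}\longrightarrow \mathcal C^{K^\triangleleft}\times_{\mathcal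 C^K}\{p\}.$$ Then $\mathcal C_{/p}$ and $\mathcal C^{K^\triangleleft}\times_{\mathcal C^K}\{p\}$ are $\infty$-categories and $\varphi$ is an equivalence of $\infty$-categories: there is a map $\psi$ in the opposite direction such that $\psi\varphi$ and $\varphi\psi$ are isomorphic to the identity functors, as objects of the corresponding functor $\infty$-categories. -/

import Mathlib

open CategoryTheory Simplicial MonoidalCategory CartesianMonoidalCategory Limits Opposite

universe u

noncomputable section

namespace InftySlice

/-- The fiber over the vertex `i` of a simplicial set `X` over `Δ[1]`, as a subcomplex of `X`:
the simplices all of whose vertices are sent to `i`. -/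
def fiberOver {X : SSet.{u}} (χ : X ⟶ Δ[1]) (i : Fin 2) : X.Subcomplex :=
  (SSet.stdSimplex.face {i}).preimage χ

/-- The map induced on fibers by a morphism `g : Y ⟶ X` over `Δ[1]`. -/
def fiberOverMap {X Y : SSet.{u}} (g : Y ⟶ X) (χ : X ⟶ Δ[1]) (i : Fin 2) :
    (fiberOver (g ≫ χ) i : SSet.{u}) ⟶ (fiberOver χ i : SSet.{u}) :=
  Subfunctor.lift ((fiberOver (g ≫ χ) i).ι ≫ g) (by
    rintro n _ ⟨⟨x, hx⟩, rfl⟩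
    exact hx)

/-- The data of a map from `X` to the join `A ⋆ B`: a map `χ : X ⟶ Δ[1]` together with a map to `A`
from the fiber of `χ` over `0` and a map to `B` from the fiber of `χ` over `1`. -/
structure JoinData (X A B : SSet.{u}) where
  χ : X ⟶ Δ[1]
  left : (fiberOver χ 0 : SSet.{u}) ⟶ A
  right : (fiberOver χ 1 : SSet.{u}) ⟶ B

theorem JoinData.ext_of_apply {X A B : SSet.{u}} {d d' : JoinData X A B} (h : d.χ = d'.χ)
    (hl : ∀ n x hx hx', d.left.app n ⟨x, hx⟩ = d'.left.app n ⟨x, hx'⟩)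
    (hr : ∀ n x hx hx', d.right.app n ⟨x, hx⟩ = d'.right.app n ⟨x, hx'⟩) : d = d' := by
  obtain ⟨χ, l, r⟩ := d
  obtain ⟨χ', l', r'⟩ := d'
  obtain rfl : χ = χ' := h
  have h₁ : l = l' := NatTrans.ext (funext fun n => ConcreteCategory.hom_ext _ _ fun x =>
    hl n x.1 x.2 x.2)
  have h₂ : r = r' := NatTrans.ext (funext fun n => ConcreteCategory.hom_ext _ _ fun x =>
    hr n x.1 x.2 x.2)
  rw [h₁, h₂]

/-- Restriction of `JoinData` along a morphism. -/
def JoinData.precomp {X Y A B : SSet.{u}} (g : Y ⟶ X) (d : JoinData X A B) : JoinData Y A B where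
  χ := g ≫ d.χ
  left := fiberOverMap g d.χ 0 ≫ d.left
  right := fiberOverMap g d.χ 1 ≫ d.right

theorem JoinData.precomp_id {X A B : SSet.{u}} (d : JoinData X A B) : d.precomp (𝟙 X) = d := rfl

theorem JoinData.precomp_precomp {X Y Z A B : SSet.{u}} (h : Z ⟶ Y) (g : Y ⟶ X)
    (d : JoinData X A B) : (d.precomp g).precomp h = d.precomp (h ≫ g) := rfl

/-- The join `A ⋆ B` of simplicial sets. An `n`-simplex consists of a map `Δ[n] ⟶ Δ[1]`, a map to
`A` from its fiber over `0` and a map to `B` from its fiber over `1`. (Such a fiber is empty or a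
face of `Δ[n]`, so this is a simplex of `A`, or a simplex of `B`, or one of each.) -/
def join (A B : SSet.{u}) : SSet.{u} where
  obj n := JoinData (SSet.stdSimplex.obj n.unop) A B
  map f := ↾fun d => d.precomp (SSet.stdSimplex.map f.unop)
  map_id n := by
    refine ConcreteCategory.hom_ext _ _ fun d => ?_
    exact (congrArg (fun g => d.precomp g) (SSet.stdSimplex.map_id n.unop)).trans d.precomp_id
  map_comp f g := by
    refine ConcreteCategory.hom_ext _ _ fun d => ?_
    exact (congrArg (fun h => d.precomp h) (SSet.stdSimplex.map_comp g.unop f.unop)).trans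
      (d.precomp_precomp _ _).symm

/-- The map to a join determined by `JoinData`: a simplex `x` of `X` is sent to the restriction of
the data along `x : Δ[n] ⟶ X`. -/
def JoinData.toHom {X A B : SSet.{u}} (d : JoinData X A B) : X ⟶ join A B where
  app n := ↾fun x => (d.precomp (SSet.yonedaEquiv.symm x : SSet.stdSimplex.obj n.unop ⟶ X))
  naturality n m f := by
    refine ConcreteCategory.hom_ext _ _ fun x => ?_
    exact congrArg (fun g => d.precomp g)
      (SSet.yonedaEquiv_symm_naturality_left f.unop x).symm

theorem comp_toHom {X Y A B : SSet.{u}} (g : Y ⟶ X) (d : JoinData X A B) :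
    g ≫ d.toHom = (d.precomp g).toHom := by
  refine NatTrans.ext (funext fun n => ConcreteCategory.hom_ext _ _ fun x => ?_)
  exact congrArg (fun k => d.precomp k) (SSet.yonedaEquiv_symm_comp x g).symm

/-- The projection `A ⋆ B ⟶ Δ[1]`. -/
def joinProj (A B : SSet.{u}) : join A B ⟶ Δ[1] where
  app n := ↾fun (d : JoinData (SSet.stdSimplex.obj n.unop) A B) => SSet.yonedaEquiv d.χ
  naturality n m f := by
    refine ConcreteCategory.hom_ext _ _ fun d => ?_
    exact (SSet.yonedaEquiv_naturality f.unop
      (JoinData.χ (X := SSet.stdSimplex.obj n.unop) d)).symm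

/-- The functoriality of the join in its first variable. -/
def joinMap {A A' : SSet.{u}} (f : A ⟶ A') (B : SSet.{u}) : join A B ⟶ join A' B where
  app n := ↾fun (d : JoinData (SSet.stdSimplex.obj n.unop) A B) =>
    (⟨d.χ, d.left ≫ f, d.right⟩ : JoinData (SSet.stdSimplex.obj n.unop) A' B)
  naturality _ _ _ := rfl

theorem toHom_comp_joinMap {X A A' B : SSet.{u}} (d : JoinData X A B) (f : A ⟶ A') :
    d.toHom ≫ joinMap f B = JoinData.toHom ⟨d.χ, d.left ≫ f, d.right⟩ := rfl

/-- The canonical map from the fiber of `A ⋆ B ⟶ Δ[1]` over `1` to `B`. -/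
def joinFiberOne (A B : SSet.{u}) : (fiberOver (joinProj A B) 1 : SSet.{u}) ⟶ B where
  app n := ↾fun d => (JoinData.right (X := SSet.stdSimplex.obj n.unop) d.1).app n
    ⟨SSet.yonedaEquiv (𝟙 (SSet.stdSimplex.obj n.unop)), d.2⟩
  naturality n m f := by
    refine ConcreteCategory.hom_ext _ _ fun d => ?_
    have h := NatTrans.naturality_apply (JoinData.right (X := SSet.stdSimplex.obj n.unop) d.1) f
      ⟨SSet.yonedaEquiv (𝟙 (SSet.stdSimplex.obj n.unop)), d.2⟩
    refine Eq.trans ?_ h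
    refine congrArg ((JoinData.right (X := SSet.stdSimplex.obj n.unop) d.1).app m) ?_
    refine Subtype.ext ?_
    exact (SSet.yonedaEquiv_naturality f.unop (𝟙 (SSet.stdSimplex.obj n.unop))).symm

/-- The fiber over `0` of a map to `Δ[1]` that is constant with value `1` is empty. -/
theorem isEmpty_fiberOver_zero (X : SSet.{u}) (n : SimplexCategoryᵒᵖ)
    (x : (fiberOver (SSet.const (SSet.stdSimplex.obj₀Equiv.symm 1) : X ⟶ Δ[1]) 0).obj n) :
    False := by
  have h := (SSet.stdSimplex.mem_face_iff (n := 1) (d := n.unop.len) _ _).1 x.2 0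
  exact absurd (Finset.mem_singleton.1 h) (by change ¬ (1 : Fin 2) = 0; decide)

/-- The inclusion `B ⟶ A ⋆ B`. -/
def joinInr (A B : SSet.{u}) : B ⟶ join A B :=
  JoinData.toHom
    { χ := SSet.const (SSet.stdSimplex.obj₀Equiv.symm 1)
      left :=
        { app := fun n => ↾fun x => (isEmpty_fiberOver_zero B n x).elim
          naturality := fun n _ _ => by
            refine ConcreteCategory.hom_ext _ _ fun x => ?_
            exact (isEmpty_fiberOver_zero B n x).elim }
      right := (fiberOver (SSet.const (SSet.stdSimplex.obj₀Equiv.symm 1)) 1).ι }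

theorem joinInr_joinMap {A A' : SSet.{u}} (f : A ⟶ A') (B : SSet.{u}) :
    joinInr A B ≫ joinMap f B = joinInr A' B := by
  rw [joinInr, joinInr, toHom_comp_joinMap]
  refine congrArg JoinData.toHom (JoinData.ext_of_apply rfl ?_ ?_)
  · exact fun n x hx _ => (isEmpty_fiberOver_zero B n ⟨x, hx⟩).elim
  · exact fun _ _ _ _ => rfl

/-- The left cone `K^◁ = Δ[0] ⋆ K`. -/
abbrev leftCone (K : SSet.{u}) : SSet.{u} := join Δ[0] K

/-- The slice `C_{/p}`: its `n`-simplices are the maps `Δ[n] ⋆ K ⟶ C` that restrict to `p` on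
`K`. -/
def slice {K C : SSet.{u}} (p : K ⟶ C) : SSet.{u} where
  obj n := {f : join (SSet.stdSimplex.obj n.unop) K ⟶ C // joinInr _ K ≫ f = p}
  map g := ↾fun f => ⟨joinMap (SSet.stdSimplex.map g.unop) K ≫ f.1, by
    rw [← Category.assoc, joinInr_joinMap, f.2]⟩
  map_id n := by
    refine ConcreteCategory.hom_ext _ _ fun f => Subtype.ext ?_
    exact (congrArg (fun h => joinMap h K ≫ f.1) (SSet.stdSimplex.map_id n.unop))
  map_comp g h := by
    refine ConcreteCategory.hom_ext _ _ fun f => Subtype.ext ?_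
    exact (congrArg (fun k => joinMap k K ≫ f.1) (SSet.stdSimplex.map_comp h.unop g.unop))

/-- The vertex of the simplicial set `Y ^ X` of maps corresponding to a map `f : X ⟶ Y`. -/
def mapVertex {X Y : SSet.{u}} (f : X ⟶ Y) : ((ihom X).obj Y) _⦋0⦌ :=
  SSet.yonedaEquiv (MonoidalClosed.curry (fst X Δ[0] ≫ f))

/-- The restriction map `C ^ (K^◁) ⟶ C ^ K`. -/
abbrev restrictCone (K C : SSet.{u}) :
    (ihom (leftCone K)).obj C ⟶ (ihom K).obj C :=
  (MonoidalClosed.pre (joinInr Δ[0] K)).app C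

/-- The fiber `C ^ (K^◁) ×_{C ^ K} {p}`. -/
abbrev coneFiber {K C : SSet.{u}} (p : K ⟶ C) : SSet.{u} :=
  pullback (restrictCone K C) (SSet.yonedaEquiv.symm (mapVertex p) : Δ[0] ⟶ (ihom K).obj C)

/-- The map `K^◁ × W ⟶ W ⋆ K` which lies over the projection `K^◁ ⟶ Δ[1]` and is given by the
projections to `W` and `K` on the fibers `Δ[0] × W` and `K × W` over `0` and `1`. -/
def coneToJoin (W K : SSet.{u}) : leftCone K ⊗ W ⟶ join W K :=
  JoinData.toHom
    { χ := fst (leftCone K) W ≫ joinProj Δ[0] K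
      left := (fiberOver (fst (leftCone K) W ≫ joinProj Δ[0] K) 0).ι ≫ snd (leftCone K) W
      right := fiberOverMap (fst (leftCone K) W) (joinProj Δ[0] K) 1 ≫ joinFiberOne Δ[0] K }

theorem coneToJoin_natural {W W' : SSet.{u}} (g : W ⟶ W') (K : SSet.{u}) :
    leftCone K ◁ g ≫ coneToJoin W' K = coneToJoin W K ≫ joinMap g K := by
  rw [coneToJoin, comp_toHom]
  rfl

theorem joinInr_coneToJoin (W K : SSet.{u}) :
    joinInr Δ[0] K ▷ W ≫ coneToJoin W K = fst K W ≫ joinInr W K := by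
  rw [coneToJoin, joinInr, joinInr, comp_toHom, comp_toHom]
  refine congrArg JoinData.toHom (JoinData.ext_of_apply rfl ?_ ?_)
  · exact fun n x _ hx => (isEmpty_fiberOver_zero K n ⟨x.1, hx⟩).elim
  · intro n x hx hx'
    exact SSet.yonedaEquiv_symm_app_id x.1

/-- The map `C_{/p} ⟶ C ^ (K^◁)` sending `f : Δ[n] ⋆ K ⟶ C` to the simplex given by the composite
`K^◁ × Δ[n] ⟶ Δ[n] ⋆ K ⟶ C`. -/
def sliceToCone {K C : SSet.{u}} (p : K ⟶ C) : slice p ⟶ (ihom (leftCone K)).obj C where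
  app n := ↾fun f => SSet.yonedaEquiv
    (MonoidalClosed.curry (coneToJoin (SSet.stdSimplex.obj n.unop) K ≫ f.1))
  naturality n m g := by
    refine ConcreteCategory.hom_ext _ _ fun f => ?_
    refine Eq.trans (congrArg (fun k => SSet.yonedaEquiv (MonoidalClosed.curry k)) ?_)
      (Eq.trans (congrArg SSet.yonedaEquiv (MonoidalClosed.curry_natural_left
        (SSet.stdSimplex.map g.unop) (coneToJoin (SSet.stdSimplex.obj n.unop) K ≫ f.1)))
        (SSet.yonedaEquiv_naturality g.unop _).symm)
    exact (congrArg (fun k => k ≫ f.1) (coneToJoin_natural (SSet.stdSimplex.map g.unop) K)).symm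

theorem sliceToCone_restrictCone {K C : SSet.{u}} (p : K ⟶ C) :
    sliceToCone p ≫ restrictCone K C =
      SSet.stdSimplex.isTerminalObj₀.from (slice p) ≫ SSet.yonedaEquiv.symm (mapVertex p) := by
  refine NatTrans.ext (funext fun n => ConcreteCategory.hom_ext _ _ fun f => ?_)
  have h₁ : MonoidalClosed.curry (coneToJoin (SSet.stdSimplex.obj n.unop) K ≫ f.1) ≫
      restrictCone K C = MonoidalClosed.curry (fst K (SSet.stdSimplex.obj n.unop) ≫ p) := by
    rw [MonoidalClosed.curry_pre_app, ← Category.assoc, joinInr_coneToJoin, Category.assoc, f.2]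
  have h₂ : SSet.stdSimplex.isTerminalObj₀.from (SSet.stdSimplex.obj n.unop) ≫
      MonoidalClosed.curry (fst K Δ[0] ≫ p) =
        MonoidalClosed.curry (fst K (SSet.stdSimplex.obj n.unop) ≫ p) := by
    rw [← MonoidalClosed.curry_natural_left, whiskerLeft_fst_assoc]
  have h₃ : SSet.yonedaEquiv.symm f ≫ SSet.stdSimplex.isTerminalObj₀.from (slice p) =
      SSet.stdSimplex.isTerminalObj₀.from (SSet.stdSimplex.obj n.unop) :=
    SSet.stdSimplex.isTerminalObj₀.hom_ext _ _
  have h₄ : SSet.yonedaEquiv.symm f ≫ (SSet.stdSimplex.isTerminalObj₀.from (slice p) ≫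
      SSet.yonedaEquiv.symm (mapVertex p)) =
        MonoidalClosed.curry (fst K (SSet.stdSimplex.obj n.unop) ≫ p) := by
    rw [← Category.assoc, h₃, mapVertex, Equiv.symm_apply_apply, h₂]
  rw [SSet.yonedaEquiv_symm_comp] at h₄
  refine Eq.trans ?_ (SSet.yonedaEquiv.symm_apply_eq.1 h₄).symm
  exact congrArg SSet.yonedaEquiv h₁

/-- The canonical comparison map `C_{/p} ⟶ C ^ (K^◁) ×_{C ^ K} {p}`. -/
def sliceComparison {K C : SSet.{u}} (p : K ⟶ C) : slice p ⟶ coneFiber p :=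
  pullback.lift (sliceToCone p) (SSet.stdSimplex.isTerminalObj₀.from (slice p))
    (sliceToCone_restrictCone p)

/-- Two maps `f g : X ⟶ Y` are isomorphic as objects of `Y ^ X`: there is an edge from `f` to `g`
in `Y ^ X` that has a homotopy inverse. -/
def AreIsomorphic {X Y : SSet.{u}} (f g : X ⟶ Y) : Prop :=
  ∃ e : SSet.Edge (mapVertex f) (mapVertex g), Nonempty e.InvStruct

/-- A functor `F : X ⟶ Y` between `∞`-categories is an equivalence if it has an inverse up to
isomorphism of functors. -/
def IsInftyEquivalence {X Y : SSet.{u}} (F : X ⟶ Y) : Prop :=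
  ∃ G : Y ⟶ X, AreIsomorphic (F ≫ G) (𝟙 X) ∧ AreIsomorphic (G ≫ F) (𝟙 Y)

end InftySlice
end

/-!
For subsets `S` and `T` of the vertices of `Δ[r]`, the generalized join `W ⋆ K` of shape `(S, T)`
represents maps to `Δ[r]` together with a map to `W` from the part over `S` and a map to `K` from
the part over `T`. Over `Δ[1]`, with `T = {1}`, the choice `S = {0}` gives the join `W ⋆ K`, and
`S = {0, 1}` gives the product `W × K^◁`. So both sides of the comparison are slices for
generalized joins with `T` the complement of `0`, and the comparison is restriction along the map
of shapes that forgets the map to `W` over `1`.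

Restricting the generalized slice from `Δ[r]` to its edge `0 ⟶ 1`, where `S` is not changed over
this edge, is a trivial fibration: the inclusions of simplicial sets against which one has to lift
are inner anodyne, because the missing simplices can be matched in pairs by adding or removing a
well-chosen inner vertex over `1`.

Let `X` be the generalized slice for `S = {0, 1}` over `Δ[2]`. It restricts to the fiber side along
`0 ⟶ 1`, by a trivial fibration `r₀₁`, and to the slice along `0 ⟶ 2`, by a map `r₀₂`. A section
of `r₀₁` followed by `r₀₂` is the inverse of the comparison `φ`: the degeneracy
`Δ[2] ⟶ Δ[1]` gives a map from the slice to `X` lifting `φ` along `r₀₁` and `𝟙` along `r₀₂`, and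
`r₀₂ ≫ φ` is isomorphic to `r₀₁`, since after enlarging `S` to `{0, 1, 2}` the two restrictions have
a common section and the first one is a trivial fibration.
-/

noncomputable section

namespace InftySlice

/-! ### Generalized joins -/

/-- The subcomplex of a simplicial set `X` over `Δ[r]` of the simplices all of whose vertices are
sent to `S`. -/
def part {r : ℕ} {X : SSet.{u}} (χ : X ⟶ Δ[r]) (S : Finset (Fin (r + 1))) : X.Subcomplex :=
  (SSet.stdSimplex.face S).preimage χ

/-- The map induced on parts by a morphism over `Δ[r]`. -/
def partMap {r : ℕ} {X Y : SSet.{u}} (g : Y ⟶ X) (χ : X ⟶ Δ[r]) (S : Finset (Fin (r + 1))) :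
    (part (g ≫ χ) S : SSet.{u}) ⟶ (part χ S : SSet.{u}) :=
  Subfunctor.lift ((part (g ≫ χ) S).ι ≫ g) (by
    rintro n _ ⟨⟨x, hx⟩, rfl⟩
    exact hx)

/-- A map from `X` to the generalized join of `A` and `B`: a map to `Δ[r]` together with a map to
`A` from the part over `S` and a map to `B` from the part over `T`. -/
structure PartsData {r : ℕ} (S T : Finset (Fin (r + 1))) (X A B : SSet.{u}) where
  χ : X ⟶ Δ[r]
  left : (part χ S : SSet.{u}) ⟶ A
  right : (part χ T : SSet.{u}) ⟶ B

section

variable {r : ℕ} {S T : Finset (Fin (r + 1))}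

theorem PartsData.ext_of_apply {X A B : SSet.{u}} {d d' : PartsData S T X A B} (h : d.χ = d'.χ)
    (hl : ∀ n x hx hx', d.left.app n ⟨x, hx⟩ = d'.left.app n ⟨x, hx'⟩)
    (hr : ∀ n x hx hx', d.right.app n ⟨x, hx⟩ = d'.right.app n ⟨x, hx'⟩) : d = d' := by
  obtain ⟨χ, l, r⟩ := d
  obtain ⟨χ', l', r'⟩ := d'
  obtain rfl : χ = χ' := h
  have h₁ : l = l' := NatTrans.ext (funext fun n => ConcreteCategory.hom_ext _ _ fun x =>
    hl n x.1 x.2 x.2)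
  have h₂ : r = r' := NatTrans.ext (funext fun n => ConcreteCategory.hom_ext _ _ fun x =>
    hr n x.1 x.2 x.2)
  rw [h₁, h₂]

/-- Restriction of `PartsData` along a morphism. -/
def PartsData.precomp {X Y A B : SSet.{u}} (g : Y ⟶ X) (d : PartsData S T X A B) :
    PartsData S T Y A B where
  χ := g ≫ d.χ
  left := partMap g d.χ S ≫ d.left
  right := partMap g d.χ T ≫ d.right

variable (S T) in
/-- The generalized join of `A` and `B`. -/
def partsJoin (A B : SSet.{u}) : SSet.{u} where
  obj n := PartsData S T (SSet.stdSimplex.obj n.unop) A B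
  map f := ↾fun d => d.precomp (SSet.stdSimplex.map f.unop)
  map_id n := by
    refine ConcreteCategory.hom_ext _ _ fun d => ?_
    exact congrArg (fun g => d.precomp g) (SSet.stdSimplex.map_id n.unop)
  map_comp f g := by
    refine ConcreteCategory.hom_ext _ _ fun d => ?_
    exact congrArg (fun h => d.precomp h) (SSet.stdSimplex.map_comp g.unop f.unop)

/-- The functoriality of the generalized join in its first variable. -/
def mapLeft {A A' : SSet.{u}} (f : A ⟶ A') (B : SSet.{u}) :
    partsJoin S T A B ⟶ partsJoin S T A' B where
  app n := ↾fun (d : PartsData S T (SSet.stdSimplex.obj n.unop) A B) =>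
    (⟨d.χ, d.left ≫ f, d.right⟩ : PartsData S T (SSet.stdSimplex.obj n.unop) A' B)
  naturality _ _ _ := rfl

variable (S T) in
/-- Exchanging the two variables of the generalized join. -/
def partsSwap (A B : SSet.{u}) : partsJoin S T A B ⟶ partsJoin T S B A where
  app n := ↾fun (d : PartsData S T (SSet.stdSimplex.obj n.unop) A B) =>
    (⟨d.χ, d.right, d.left⟩ : PartsData T S (SSet.stdSimplex.obj n.unop) B A)
  naturality _ _ _ := rfl

/-- The vertices of a simplex of a standard simplex. -/
def vertexOf {n : SimplexCategory} {k : SimplexCategoryᵒᵖ}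
    (x : (SSet.stdSimplex.obj n : SSet.{u}).obj k) (i : Fin (k.unop.len + 1)) : Fin (n.len + 1) :=
  (SSet.stdSimplex.objEquiv x).toOrderHom i

theorem vertexOf_ext {n : SimplexCategory} {k : SimplexCategoryᵒᵖ}
    {x y : (SSet.stdSimplex.obj n : SSet.{u}).obj k} (h : ∀ i, vertexOf x i = vertexOf y i) :
    x = y :=
  SSet.stdSimplex.ext (n := n.len) (d := k.unop.len) _ _ h

theorem vertexOf_monotone {n : SimplexCategory} {k : SimplexCategoryᵒᵖ}
    (x : (SSet.stdSimplex.obj n : SSet.{u}).obj k) : Monotone (vertexOf x) :=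
  (SSet.stdSimplex.objEquiv x).toOrderHom.monotone

/-- The vertices of `Δ[r]` corresponding to the vertices of a simplex of the generalized join. -/
def PartsData.vertex {n : SimplexCategory} {A B : SSet.{u}}
    (d : PartsData S T (SSet.stdSimplex.obj n) A B) (i : Fin (n.len + 1)) : Fin (r + 1) :=
  vertexOf (SSet.yonedaEquiv d.χ) i

theorem vertexOf_app {n m : SimplexCategory}
    (χ : (SSet.stdSimplex.obj n : SSet.{u}) ⟶ SSet.stdSimplex.obj m)
    {k : SimplexCategoryᵒᵖ} (x : (SSet.stdSimplex.obj n : SSet.{u}).obj k)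
    (i : Fin (k.unop.len + 1)) :
    vertexOf (χ.app k x) i = vertexOf (SSet.yonedaEquiv χ) (vertexOf x i) := by
  obtain ⟨y, rfl⟩ := SSet.yonedaEquiv.symm.surjective χ
  rw [Equiv.apply_symm_apply]
  rfl

theorem vertexOf_yonedaEquiv_comp {N' N m : SimplexCategory} (f : N' ⟶ N)
    (χ : (SSet.stdSimplex.obj N : SSet.{u}) ⟶ SSet.stdSimplex.obj m) (i : Fin (N'.len + 1)) :
    vertexOf (SSet.yonedaEquiv (SSet.stdSimplex.map f ≫ χ)) i =
      vertexOf (SSet.yonedaEquiv χ) (f.toOrderHom i) :=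
  congrArg (fun z => vertexOf z i) (SSet.yonedaEquiv_naturality f χ).symm

theorem mem_part_iff {N : SimplexCategory} (χ : SSet.stdSimplex.{u}.obj N ⟶ Δ[r])
    (U : Finset (Fin (r + 1))) {k : SimplexCategoryᵒᵖ}
    (x : (SSet.stdSimplex.obj N : SSet.{u}).obj k) :
    x ∈ (part χ U).obj k ↔ ∀ i, vertexOf (SSet.yonedaEquiv χ) (vertexOf x i) ∈ U := by
  refine (SSet.stdSimplex.mem_face_iff (d := k.unop.len) _ _).trans ?_
  refine forall_congr' fun i => ?_
  exact iff_of_eq (congrArg (· ∈ U) (vertexOf_app χ x i))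

theorem exists_monotone_retraction {α : Type*} [LinearOrder α] {U : Finset α}
    (hU : U.Nonempty) : ∃ a : α →o α, (∀ i, a i ∈ U) ∧ ∀ i ∈ U, a i = i := by
  let f (i j : α) : α := if j ≤ i then j else U.min' hU
  have f_mono {i i' : α} (h : i ≤ i') {j : α} (hj : j ∈ U) : f i j ≤ f i' j := by
    by_cases hij : j ≤ i
    · simp only [f, if_pos hij, if_pos (hij.trans h), le_refl]
    · simp only [f, if_neg hij]
      split_ifs
      exacts [U.min'_le j hj, le_rfl]
  refine ⟨⟨fun i => U.sup' hU (f i), fun i i' h => ?_⟩, fun i => ?_, fun i hi => le_antisymm ?_ ?_⟩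
  · exact Finset.sup'_le hU _ fun j hj => Finset.le_sup'_of_le _ hj (f_mono h hj)
  · obtain ⟨j, hj, hij⟩ := Finset.exists_mem_eq_sup' hU (f i)
    change U.sup' hU (f i) ∈ U
    rw [hij]
    simp only [f]
    split_ifs
    exacts [hj, U.min'_mem hU]
  · refine Finset.sup'_le hU _ fun j _ => ?_
    simp only [f]
    split_ifs with hji
    exacts [hji, U.min'_le i hi]
  · exact Finset.le_sup'_of_le _ hi (if_pos le_rfl).ge

theorem exists_retraction_part {n : SimplexCategory} {χ : SSet.stdSimplex.{u}.obj n ⟶ Δ[r]}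
    {U : Finset (Fin (r + 1))} {i₀ : Fin (n.len + 1)}
    (h₀ : vertexOf (SSet.yonedaEquiv χ) i₀ ∈ U) :
    ∃ a : (SSet.stdSimplex.obj n : SSet.{u}) ⟶ (part χ U : SSet.{u}),
      (part χ U).ι ≫ a = 𝟙 _ := by
  have hne : (Finset.univ.filter fun i => vertexOf (SSet.yonedaEquiv χ) i ∈ U).Nonempty :=
    ⟨i₀, Finset.mem_filter_univ _ |>.2 h₀⟩
  obtain ⟨a, ha, ha'⟩ := exists_monotone_retraction hne
  simp only [Finset.mem_filter_univ] at ha ha'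
  refine ⟨Subfunctor.lift (SSet.stdSimplex.map (SimplexCategory.Hom.mk a)) ?_, ?_⟩
  · rintro k _ ⟨x, rfl⟩
    exact (mem_part_iff _ _ _).2 fun i => ha _
  · refine NatTrans.ext (funext fun k => ConcreteCategory.hom_ext _ _ fun x => Subtype.ext ?_)
    exact vertexOf_ext fun i => ha' _ ((mem_part_iff χ U x.1).1 x.2 i)

theorem part_comp_le {X : SSet.{u}} (χ : X ⟶ Δ[r]) {r' : ℕ} {U' : Finset (Fin (r' + 1))}
    {U : Finset (Fin (r + 1))} (d : ⦋r⦌ ⟶ ⦋r'⦌) (h : ∀ i, d.toOrderHom i ∈ U' → i ∈ U) :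
    part (χ ≫ SSet.stdSimplex.map d) U' ≤ part χ U := by
  intro k x hx
  exact (SSet.stdSimplex.mem_face_iff (d := k.unop.len) _ _).2 fun i =>
    h _ ((SSet.stdSimplex.mem_face_iff (d := k.unop.len) _ _).1 hx i)

/-- The functoriality of the generalized join in the shape. -/
def reindex {r' : ℕ} {S' T' : Finset (Fin (r' + 1))} (d : ⦋r⦌ ⟶ ⦋r'⦌)
    (hS : ∀ i, d.toOrderHom i ∈ S' → i ∈ S) (hT : ∀ i, d.toOrderHom i ∈ T' → i ∈ T)
    (A B : SSet.{u}) : partsJoin S T A B ⟶ partsJoin S' T' A B where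
  app n := ↾fun (t : PartsData S T (SSet.stdSimplex.obj n.unop) A B) =>
    (⟨t.χ ≫ SSet.stdSimplex.map d, SSet.Subcomplex.homOfLE (part_comp_le t.χ d hS) ≫ t.left,
      SSet.Subcomplex.homOfLE (part_comp_le t.χ d hT) ≫ t.right⟩ :
        PartsData S' T' (SSet.stdSimplex.obj n.unop) A B)
  naturality _ _ _ := rfl

end

/-- Every map to `C` from the subcomplex `A` of `X` extends to `X`. -/
def Extends (C : SSet.{u}) {X : SSet.{u}} (A : X.Subcomplex) : Prop :=
  ∀ f : (A : SSet.{u}) ⟶ C, ∃ g : X ⟶ C, A.ι ≫ g = f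

theorem extends_top (C X : SSet.{u}) : Extends C (⊤ : X.Subcomplex) := fun f =>
  ⟨(SSet.Subcomplex.topIso X).inv ≫ f, rfl⟩

theorem Extends.exists_of_compatible {ι : Type*} {X C : SSet.{u}} {Y : ι → SSet.{u}}
    {j : ∀ i, Y i ⟶ X} (hj : Extends C (⨆ i, SSet.Subcomplex.range (j i))) (h : ∀ i, Y i ⟶ C)
    (compatible : ∀ i i' n y y', (j i).app n y = (j i').app n y' →
      (h i).app n y = (h i').app n y') :
    ∃ g : X ⟶ C, ∀ i, j i ≫ g = h i := by
  have mem_range {n} (x : (⨆ i, SSet.Subcomplex.range (j i) : X.Subcomplex).obj n) :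
      ∃ i y, (j i).app n y = x.1 := by
    obtain ⟨i, y, hy⟩ := Set.mem_iUnion.1 ((Subfunctor.iSup_obj _ n).subset x.2)
    exact ⟨i, y, hy⟩
  choose i y hy using @mem_range
  obtain ⟨g, hg⟩ := hj
    { app n := ↾fun x => (h (i x)).app n (y x)
      naturality n m θ := ConcreteCategory.hom_ext _ _ fun x => by
        refine Eq.trans (compatible _ _ _ _ _ ?_) (NatTrans.naturality_apply (h (i x)) θ (y x))
        refine (hy _).trans (Eq.trans ?_ (NatTrans.naturality_apply (j (i x)) θ (y x)).symm)
        exact congrArg (X.map θ) (hy x).symm }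
  refine ⟨g, fun k => NatTrans.ext (funext fun n => ConcreteCategory.hom_ext _ _ fun z => ?_)⟩
  have hz : (j k).app n z ∈ (⨆ i, SSet.Subcomplex.range (j i) : X.Subcomplex).obj n :=
    (le_iSup (fun i => SSet.Subcomplex.range (j i)) k) n ⟨z, rfl⟩
  refine Eq.trans (ConcreteCategory.congr_hom (NatTrans.congr_app hg n) ⟨_, hz⟩) ?_
  exact compatible _ _ _ _ _ (hy ⟨_, hz⟩)

theorem exists_hom_of_compatible {ι : Type*} {X C : SSet.{u}} {Y : ι → SSet.{u}}
    (j : ∀ i, Y i ⟶ X) (h : ∀ i, Y i ⟶ C)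
    (surjective : ∀ n x, ∃ i y, (j i).app n y = x)
    (compatible : ∀ i i' n y y', (j i).app n y = (j i').app n y' →
      (h i).app n y = (h i').app n y') :
    ∃ g : X ⟶ C, ∀ i, j i ≫ g = h i := by
  have range_eq_top : (⨆ i, SSet.Subcomplex.range (j i) : X.Subcomplex) = ⊤ := by
    refine eq_top_iff.2 fun n x _ => ?_
    obtain ⟨i, y, rfl⟩ := surjective n x
    exact le_iSup (fun i => SSet.Subcomplex.range (j i)) i n ⟨y, rfl⟩
  exact Extends.exists_of_compatible (range_eq_top ▸ extends_top C X) h compatible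

/-! ### Relative maps -/

section

variable {r : ℕ} {S T : Finset (Fin (r + 1))}

variable (S T) in
/-- A family of subcomplexes of the generalized joins `L ⋆ M`, for varying `L`, that is stable under
preimages and contains the simplices that do not meet the part of `L`. -/
structure StableFamily (M : SSet.{u}) where
  obj : ∀ L : SSet.{u}, (partsJoin S T L M).Subcomplex
  mem_iff : ∀ {L L' : SSet.{u}} (g : L ⟶ L') {n} (t : (partsJoin S T L M).obj n),
    (mapLeft g M).app n t ∈ (obj L').obj n ↔ t ∈ (obj L).obj n
  mem_of_forall_notMem : ∀ {L : SSet.{u}} {n : SimplexCategoryᵒᵖ}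
    (t : PartsData S T (SSet.stdSimplex.obj n.unop) L M), (∀ i, t.vertex i ∉ S) →
      (show (partsJoin S T L M).obj n from t) ∈ (obj L).obj n

namespace StableFamily

variable {M : SSet.{u}} (F : StableFamily S T M)

/-- The functoriality of a stable family. -/
def map {L L' : SSet.{u}} (g : L ⟶ L') : (F.obj L : SSet.{u}) ⟶ (F.obj L' : SSet.{u}) :=
  Subfunctor.lift ((F.obj L).ι ≫ mapLeft g M) (by
    rintro n _ ⟨⟨x, hx⟩, rfl⟩
    exact (F.mem_iff g x).2 hx)

variable {L C : SSet.{u}} (f : (F.obj L : SSet.{u}) ⟶ C)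

/-- A simplex of `L` together with a map from its generalized join with `M` that is
compatible with `f`. -/
@[ext]
structure RelMap (n : SimplexCategory) where
  base : L.obj (op n)
  hom : partsJoin S T (SSet.stdSimplex.obj n) M ⟶ C
  comm : (F.obj (SSet.stdSimplex.obj n)).ι ≫ hom = F.map (SSet.yonedaEquiv.symm base) ≫ f

/-- Restriction of `RelMap` along a morphism of the simplex category. -/
def RelMap.restrict {n m : SimplexCategory} (g : m ⟶ n) (a : F.RelMap f n) : F.RelMap f m where
  base := L.map g.op a.base
  hom := mapLeft (SSet.stdSimplex.map g) M ≫ a.hom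
  comm := by
    have h₁ := congrArg (fun z => F.map (SSet.stdSimplex.map g) ≫ z) a.comm
    have h₂ := SSet.yonedaEquiv_symm_naturality_left g a.base
    refine Eq.trans h₁ ?_
    rw [← h₂]
    rfl

/-- The simplicial set of relative maps. -/
def relMaps : SSet.{u} where
  obj n := F.RelMap f n.unop
  map g := ↾fun a => a.restrict F f g.unop
  map_id n := by
    refine ConcreteCategory.hom_ext _ _ fun a => RelMap.ext ?_ ?_
    · exact Functor.map_id_apply L (X := n) a.base
    · exact congrArg (fun g => mapLeft g M ≫ a.hom) (SSet.stdSimplex.map_id n.unop)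
  map_comp g h := by
    refine ConcreteCategory.hom_ext _ _ fun a => RelMap.ext ?_ ?_
    · exact Functor.map_comp_apply L g h a.base
    · exact congrArg (fun g => mapLeft g M ≫ a.hom) (SSet.stdSimplex.map_comp h.unop g.unop)

/-- The projection from the simplicial set of relative maps to the base. -/
def relProj : F.relMaps f ⟶ L where
  app n := ↾fun (a : F.RelMap f n.unop) => a.base
  naturality _ _ _ := rfl

variable {F f}

/-- The map corresponding to a simplex of the simplicial set of relative maps. -/
def evalHom {n : SimplexCategory} (x : SSet.stdSimplex.obj n ⟶ F.relMaps f) :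
    partsJoin S T (SSet.stdSimplex.obj n) M ⟶ C :=
  RelMap.hom (n := n) (SSet.yonedaEquiv x)

theorem evalHom_comp {n m : SimplexCategory}
    (g : (SSet.stdSimplex.obj m : SSet.{u}) ⟶ SSet.stdSimplex.obj n)
    (x : SSet.stdSimplex.obj n ⟶ F.relMaps f) :
    evalHom (g ≫ x) = mapLeft g M ≫ evalHom x := by
  obtain ⟨θ, rfl⟩ : ∃ θ : m ⟶ n, SSet.stdSimplex.map θ = g :=
    ⟨SSet.stdSimplex.objEquiv (SSet.yonedaEquiv g), by
      exact SSet.yonedaEquiv.injective (vertexOf_ext fun i => rfl)⟩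
  exact (congrArg (RelMap.hom (n := m)) (SSet.yonedaEquiv_naturality θ x).symm)

theorem ι_evalHom {n : SimplexCategory} (x : SSet.stdSimplex.obj n ⟶ F.relMaps f) :
    (F.obj (SSet.stdSimplex.obj n)).ι ≫ evalHom x = F.map (x ≫ F.relProj f) ≫ f := by
  refine (RelMap.comm (n := n) (SSet.yonedaEquiv x)).trans ?_
  have h : (SSet.yonedaEquiv.symm (RelMap.base (n := n) (SSet.yonedaEquiv x))) =
      x ≫ F.relProj f := by
    rw [Equiv.symm_apply_eq]
    rfl
  rw [h]

theorem evalHom_app_of_mem {n : SimplexCategory} (x : SSet.stdSimplex.obj n ⟶ F.relMaps f)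
    {k} (t : (partsJoin S T (SSet.stdSimplex.obj n) M).obj k)
    (ht : t ∈ (F.obj (SSet.stdSimplex.obj n)).obj k) :
    (evalHom x).app k t = f.app k ⟨(mapLeft (x ≫ F.relProj f) M).app k t, (F.mem_iff _ _).2 ht⟩ :=
  ConcreteCategory.congr_hom (NatTrans.congr_app (ι_evalHom x) k) ⟨t, ht⟩

theorem exists_eq_mapLeft {V : SSet.{u}} {n : SimplexCategoryᵒᵖ}
    (t : PartsData S T (SSet.stdSimplex.obj n.unop) V M) {i} (hi : t.vertex i ∈ S) :
    ∃ (y : SSet.stdSimplex.obj n.unop ⟶ V)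
      (τ : (partsJoin S T (SSet.stdSimplex.obj n.unop) M).obj n), (mapLeft y M).app n τ = t ∧
      ∀ {m : SimplexCategory} (x : SSet.stdSimplex.obj m ⟶ V)
        (σ : (partsJoin S T (SSet.stdSimplex.obj m) M).obj n),
        (mapLeft x M).app n σ = t → ∃ g : SSet.stdSimplex.obj n.unop ⟶ SSet.stdSimplex.obj m,
          (mapLeft g M).app n τ = σ ∧ g ≫ x = y := by
  obtain ⟨a, ha⟩ := exists_retraction_part hi
  refine ⟨a ≫ t.left, (⟨t.χ, (part t.χ S).ι, t.right⟩ :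
    PartsData S T (SSet.stdSimplex.obj n.unop) _ M), ?_, ?_⟩
  · exact congrArg (fun l => (⟨t.χ, l, t.right⟩ : PartsData S T (SSet.stdSimplex.obj n.unop) V M))
      (by rw [← Category.assoc, ha, Category.id_comp])
  · intro m x σ hσ
    obtain ⟨χ, l, ρ⟩ := σ
    subst hσ
    refine ⟨a ≫ l, ?_, Category.assoc _ _ _⟩
    exact congrArg (fun l => (⟨χ, l, ρ⟩ : PartsData S T (SSet.stdSimplex.obj n.unop) _ M))
      ((Category.assoc _ _ _).symm.trans ((congrArg (· ≫ l) ha).trans (Category.id_comp l)))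

theorem app_eq_evalHom_app {V : SSet.{u}} (ρ : V ⟶ F.relMaps f) {m : SimplexCategory}
    (x : SSet.stdSimplex.obj m ⟶ V) {n} (t : (F.obj V : SSet.{u}).obj n)
    (σ : (partsJoin S T (SSet.stdSimplex.obj m) M).obj n) (h : (mapLeft x M).app n σ = t.1) :
    (F.map (ρ ≫ F.relProj f) ≫ f).app n t = (evalHom (x ≫ ρ)).app n σ := by
  obtain ⟨t, ht⟩ := t
  obtain rfl : _ = t := h
  rw [evalHom_app_of_mem _ _ ((F.mem_iff _ _).1 ht)]
  rfl

theorem evalHom_app_eq_of_mapLeft_app_eq {V : SSet.{u}} (ρ : V ⟶ F.relMaps f)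
    {m m' : SimplexCategory} (x : SSet.stdSimplex.obj m ⟶ V) (x' : SSet.stdSimplex.obj m' ⟶ V)
    {n} (σ : (partsJoin S T (SSet.stdSimplex.obj m) M).obj n)
    (σ' : (partsJoin S T (SSet.stdSimplex.obj m') M).obj n)
    (h : (mapLeft x M).app n σ = (mapLeft x' M).app n σ') :
    (evalHom (x ≫ ρ)).app n σ = (evalHom (x' ≫ ρ)).app n σ' := by
  by_cases hS : ∃ i, PartsData.vertex (n := n.unop) ((mapLeft x M).app n σ) i ∈ S
  · obtain ⟨i, hi⟩ := hS
    obtain ⟨y, τ, -, universal⟩ := exists_eq_mapLeft ((mapLeft x M).app n σ) hi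
    have eq_universal {k : SimplexCategory} (z : SSet.stdSimplex.obj k ⟶ V)
        (υ : (partsJoin S T (SSet.stdSimplex.obj k) M).obj n)
        (hυ : (mapLeft z M).app n υ = (mapLeft x M).app n σ) :
        (evalHom (z ≫ ρ)).app n υ = (evalHom (y ≫ ρ)).app n τ := by
      obtain ⟨g, rfl, rfl⟩ := universal z υ hυ
      rw [Category.assoc, evalHom_comp]
      rfl
    exact (eq_universal x σ rfl).trans (eq_universal x' σ' h.symm).symm
  · have ht := F.mem_of_forall_notMem _ (not_exists.1 hS)
    exact (app_eq_evalHom_app ρ x ⟨_, ht⟩ σ rfl).symm.trans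
      (app_eq_evalHom_app ρ x' ⟨_, ht⟩ σ' h.symm)

theorem exists_assembly {V : SSet.{u}} (ρ : V ⟶ F.relMaps f) :
    ∃ H : partsJoin S T V M ⟶ C,
      (∀ {n : SimplexCategory} (x : SSet.stdSimplex.obj n ⟶ V),
        mapLeft x M ≫ H = evalHom (x ≫ ρ)) ∧
      (F.obj V).ι ≫ H = F.map (ρ ≫ F.relProj f) ≫ f := by
  let Piece : Option (Σ m : SimplexCategory, SSet.stdSimplex.obj m ⟶ V) → SSet.{u} := fun i =>
    match i with
    | none => F.obj V
    | some ⟨m, _⟩ => partsJoin S T (SSet.stdSimplex.obj m) M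
  let inclusion : ∀ i, Piece i ⟶ partsJoin S T V M := fun i => match i with
    | none => (F.obj V).ι
    | some ⟨_, x⟩ => mapLeft x M
  let value : ∀ i, Piece i ⟶ C := fun i => match i with
    | none => F.map (ρ ≫ F.relProj f) ≫ f
    | some ⟨_, x⟩ => evalHom (x ≫ ρ)
  obtain ⟨H, hH⟩ : ∃ H : partsJoin S T V M ⟶ C, ∀ i, inclusion i ≫ H = value i := by
    refine exists_hom_of_compatible inclusion value (fun n t => ?_) ?_
    · by_cases hS : ∃ i, PartsData.vertex (n := n.unop) t i ∈ S
      · obtain ⟨i, hi⟩ := hS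
        obtain ⟨y, τ, h, -⟩ := exists_eq_mapLeft t hi
        exact ⟨some ⟨_, y⟩, τ, h⟩
      · exact ⟨none, ⟨t, F.mem_of_forall_notMem t (not_exists.1 hS)⟩, rfl⟩
    · rintro (_ | ⟨_, x⟩) (_ | ⟨_, x'⟩) n t t' h
      · exact congrArg (value none |>.app n) (Subtype.ext h)
      · exact app_eq_evalHom_app ρ x' t t' h.symm
      · exact (app_eq_evalHom_app ρ x t' t h).symm
      · exact evalHom_app_eq_of_mapLeft_app_eq ρ x x' t t' h
  exact ⟨H, fun {n} x => hH (some ⟨n, x⟩), hH none⟩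

theorem assembly_unique {V : SSet.{u}} {H H' : partsJoin S T V M ⟶ C}
    (h : ∀ {n : SimplexCategory} (x : SSet.stdSimplex.obj n ⟶ V), mapLeft x M ≫ H =
      mapLeft x M ≫ H') (h' : (F.obj V).ι ≫ H = (F.obj V).ι ≫ H') : H = H' := by
  refine NatTrans.ext (funext fun n => ConcreteCategory.hom_ext _ _ fun t => ?_)
  by_cases hS : ∃ i, PartsData.vertex (n := n.unop) t i ∈ S
  · obtain ⟨i, hi⟩ := hS
    obtain ⟨y, τ, rfl, -⟩ := exists_eq_mapLeft t hi
    exact ConcreteCategory.congr_hom (NatTrans.congr_app (h y) n) τ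
  · push Not at hS
    exact ConcreteCategory.congr_hom (NatTrans.congr_app h' n) ⟨t, F.mem_of_forall_notMem t hS⟩

theorem mapLeft_app_injective {A A' : SSet.{u}} (g : A ⟶ A') [Mono g] {n}
    {t t' : (partsJoin S T A M).obj n} (h : (mapLeft g M).app n t = (mapLeft g M).app n t') :
    t = t' := by
  obtain ⟨χ, l, ρ⟩ := t
  obtain ⟨χ', l', ρ'⟩ := t'
  obtain rfl : χ = χ' := congrArg PartsData.χ h
  have h₁ : l ≫ g = l' ≫ g := eq_of_heq (PartsData.mk.inj h).2.1
  obtain rfl : l = l' := (cancel_mono g).1 h₁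
  obtain rfl : ρ = ρ' := eq_of_heq (PartsData.mk.inj h).2.2
  rfl

theorem exists_hom_relMaps {V : SSet.{u}} (b : V ⟶ L) (H : partsJoin S T V M ⟶ C)
    (hH : (F.obj V).ι ≫ H = F.map b ≫ f) :
    ∃ ρ : V ⟶ F.relMaps f, ρ ≫ F.relProj f = b ∧
      ∀ {n : SimplexCategory} (x : SSet.stdSimplex.obj n ⟶ V),
        evalHom (x ≫ ρ) = mapLeft x M ≫ H := by
  have hx {n} (x : SSet.stdSimplex.obj n ⟶ V) :
      (F.obj _).ι ≫ mapLeft x M ≫ H = F.map (x ≫ b) ≫ f :=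
    congrArg (fun z => F.map x ≫ z) hH
  let ρ : V ⟶ F.relMaps f :=
    { app n := ↾fun x => (⟨b.app n x, mapLeft (SSet.yonedaEquiv.symm x) M ≫ H, by
          rw [hx, SSet.yonedaEquiv_symm_comp]⟩ : F.RelMap f n.unop)
      naturality n m g := by
        refine ConcreteCategory.hom_ext _ _ fun x => RelMap.ext ?_ ?_
        · exact NatTrans.naturality_apply b g x
        · exact congrArg (fun z => mapLeft z M ≫ H)
            (SSet.yonedaEquiv_symm_naturality_left g.unop x).symm }
  refine ⟨ρ, rfl, fun {n} x => ?_⟩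
  refine congrArg (fun z => mapLeft z M ≫ H) (Equiv.symm_apply_apply SSet.yonedaEquiv x)

theorem relMaps_hom_ext {V : SSet.{u}} {ρ ρ' : V ⟶ F.relMaps f}
    (hb : ρ ≫ F.relProj f = ρ' ≫ F.relProj f)
    (h : ∀ {n : SimplexCategory} (x : SSet.stdSimplex.obj n ⟶ V),
      evalHom (x ≫ ρ) = evalHom (x ≫ ρ')) : ρ = ρ' := by
  refine NatTrans.ext (funext fun n => ConcreteCategory.hom_ext _ _ fun x => ?_)
  refine RelMap.ext ?_ ?_
  · exact ConcreteCategory.congr_hom (NatTrans.congr_app hb n) x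
  · have := h (n := n.unop) (SSet.yonedaEquiv.symm x)
    rw [evalHom, evalHom, SSet.yonedaEquiv_symm_comp, SSet.yonedaEquiv_symm_comp,
      Equiv.apply_symm_apply, Equiv.apply_symm_apply] at this
    exact this

theorem exists_extension_of_extends {B V : SSet.{u}} (i : B ⟶ V) [Mono i]
    (hi : Extends C (F.obj V ⊔ SSet.Subcomplex.range (mapLeft i M)))
    (h : (F.obj V : SSet.{u}) ⟶ C) (H : partsJoin S T B M ⟶ C)
    (hH : (F.obj B).ι ≫ H = F.map i ≫ h) :
    ∃ g : partsJoin S T V M ⟶ C, (F.obj V).ι ≫ g = h ∧ mapLeft i M ≫ g = H := by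
  let Piece : Bool → SSet.{u} := fun b => cond b (partsJoin S T B M) (F.obj V)
  let inclusion : ∀ b, Piece b ⟶ partsJoin S T V M := fun b => match b with
    | false => (F.obj V).ι
    | true => mapLeft i M
  let value : ∀ b, Piece b ⟶ C := fun b => match b with
    | false => h
    | true => H
  have agree {n} (t : (F.obj V : SSet.{u}).obj n) (t' : (partsJoin S T B M).obj n)
      (ht : t.1 = (mapLeft i M).app n t') : h.app n t = H.app n t' := by
    obtain ⟨t, ht'⟩ := t
    obtain rfl : t = _ := ht
    exact (ConcreteCategory.congr_hom (NatTrans.congr_app hH n)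
      ⟨t', (F.mem_iff i t').1 ht'⟩).symm
  have hrange : (⨆ b, SSet.Subcomplex.range (inclusion b)) =
      F.obj V ⊔ SSet.Subcomplex.range (mapLeft i M) := by
    rw [iSup_bool_eq, sup_comm]
    exact congrArg (· ⊔ _) (Subfunctor.range_ι (F.obj V))
  obtain ⟨g, hg⟩ : ∃ g : partsJoin S T V M ⟶ C, ∀ b, inclusion b ≫ g = value b := by
    refine Extends.exists_of_compatible (hrange ▸ hi) value ?_
    rintro (_ | _) (_ | _) n t t' ht
    · exact congrArg (h.app n) (Subtype.ext ht)
    · exact agree t t' ht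
    · exact (agree t' t ht.symm).symm
    · exact congrArg (H.app n) (mapLeft_app_injective i ht)
  exact ⟨g, hg false, hg true⟩

variable (f) in
theorem relProj_mem_rlp_monomorphisms
    (hC : ∀ n : ℕ, Extends C (F.obj Δ[n] ⊔
      SSet.Subcomplex.range (mapLeft (SSet.boundary n).ι M))) :
    (MorphismProperty.monomorphisms SSet.{u}).rlp (F.relProj f) := by
  rw [SSet.rlp_monomorphisms]
  rintro _ _ _ ⟨n⟩
  refine ⟨fun {ρ x} sq => ?_⟩
  obtain ⟨H, hH, hH'⟩ := exists_assembly ρ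
  rw [sq.w] at hH'
  obtain ⟨g, hg, hg'⟩ := exists_extension_of_extends _ (hC n) (F.map x ≫ f) H hH'
  obtain ⟨l, hl, hl'⟩ := exists_hom_relMaps x g hg
  refine ⟨⟨⟨l, relMaps_hom_ext ?_ fun y => ?_, hl⟩⟩⟩
  · rw [Category.assoc, hl, sq.w]
  · rw [← hH, ← hg', ← Category.assoc, hl']
    rfl

theorem extends_of_cells
    (hC : ∀ n : ℕ, Extends C (F.obj Δ[n] ⊔
      SSet.Subcomplex.range (mapLeft (SSet.boundary n).ι M))) : Extends C (F.obj L) := by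
  intro f
  have sq : CommSq (initial.to (F.relMaps f)) (initial.to L) (F.relProj f) (𝟙 L) :=
    ⟨initialIsInitial.hom_ext _ _⟩
  have := relProj_mem_rlp_monomorphisms f hC (initial.to L)
    (MorphismProperty.monomorphisms.infer_property _)
  obtain ⟨H, -, hH⟩ := exists_assembly sq.lift
  refine ⟨H, hH.trans ?_⟩
  rw [sq.fac_right]
  rfl

end StableFamily

end

/-! ### Inner pairings from corners of vertex sets -/

/-- A description of the simplices of `X` by their vertices in a linear order `V`:
the simplices are the increasing sequences whose set of entries is a face, for a given notion of
face. -/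
structure VertexModel (X : SSet.{u}) (V : Type) [LinearOrder V] where
  vert : ∀ {n : ℕ}, X _⦋n⦌ → (Fin (n + 1) →o V)
  vert_map : ∀ {n m : ℕ} (f : ⦋m⦌ ⟶ ⦋n⦌) (x : X _⦋n⦌) (i : Fin (m + 1)),
    vert (X.map f.op x) i = vert x (f.toOrderHom i)
  vert_injective : ∀ {n : ℕ} {x y : X _⦋n⦌}, (∀ i, vert x i = vert y i) → x = y
  IsFace : Finset V → Prop
  isFace_image_vert : ∀ {n : ℕ} (x : X _⦋n⦌), IsFace (Finset.univ.image (vert x))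
  exists_simplex : ∀ {n : ℕ} (S : Finset V) (h : S.card = n + 1), IsFace S →
    ∃ x : X _⦋n⦌, ∀ i, vert x i = S.orderEmbOfFin h i

namespace VertexModel

variable {X : SSet.{u}} {V : Type} [LinearOrder V] (E : VertexModel X V)

/-- The set of vertices of a simplex. -/
def vertexSet {n : ℕ} (x : X _⦋n⦌) : Finset V := Finset.univ.image (E.vert x)

theorem vertexSet_map_subset {n m : ℕ} (f : ⦋m⦌ ⟶ ⦋n⦌) (x : X _⦋n⦌) :
    E.vertexSet (X.map f.op x) ⊆ E.vertexSet x := by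
  intro v hv
  obtain ⟨i, -, rfl⟩ := Finset.mem_image.1 hv
  rw [E.vert_map]
  exact Finset.mem_image_of_mem _ (Finset.mem_univ _)

theorem nonDegenerate_of_injective {n : ℕ} {x : X _⦋n⦌} (h : Function.Injective (E.vert x)) :
    x ∈ X.nonDegenerate n := by
  rw [SSet.mem_nonDegenerate_iff_notMem_degenerate]
  rintro ⟨m, hm, f, y, rfl⟩
  have hf : Function.Injective f.toOrderHom := fun i j hij => h (by
    rw [E.vert_map, E.vert_map, hij])
  have := Fintype.card_le_of_injective _ hf
  simp only [Fintype.card_fin, SimplexCategory.len_mk] at this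
  omega

theorem injective_of_nonDegenerate {n : ℕ} {x : X _⦋n⦌} (h : x ∈ X.nonDegenerate n) :
    Function.Injective (E.vert x) := by
  by_contra hinj
  have hcard : (E.vertexSet x).card < n + 1 := by
    refine lt_of_le_of_ne (Finset.card_image_le.trans (by simp)) fun h' => hinj ?_
    rw [← Set.injOn_univ, ← Finset.coe_univ]
    exact Finset.card_image_iff.1 (h'.trans (by simp))
  have hpos : 0 < (E.vertexSet x).card :=
    Finset.card_pos.2 ⟨_, Finset.mem_image_of_mem _ (Finset.mem_univ 0)⟩
  obtain ⟨m, hm⟩ : ∃ m, (E.vertexSet x).card = m + 1 := ⟨_, (Nat.succ_pred_eq_of_pos hpos).symm⟩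
  obtain ⟨y, hy⟩ := E.exists_simplex _ hm (E.isFace_image_vert x)
  let e := (E.vertexSet x).orderIsoOfFin hm
  have hx (i) : E.vert x i ∈ E.vertexSet x := Finset.mem_image_of_mem _ (Finset.mem_univ i)
  let f : ⦋n⦌ ⟶ ⦋m⦌ := SimplexCategory.mkHom
    { toFun := fun i => e.symm ⟨E.vert x i, hx i⟩
      monotone' := fun i j hij => e.symm.monotone (by exact (E.vert x).monotone hij) }
  refine (SSet.mem_nonDegenerate_iff_notMem_degenerate _ _).1 h ⟨m, by omega, f, y, ?_⟩
  refine E.vert_injective fun i => ?_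
  rw [E.vert_map, hy]
  change (E.vertexSet x).orderEmbOfFin hm (e.symm ⟨E.vert x i, hx i⟩) = _
  rw [← Finset.coe_orderIsoOfFin_apply]
  change ((e (e.symm ⟨E.vert x i, hx i⟩) : E.vertexSet x) : V) = _
  rw [OrderIso.apply_symm_apply]

theorem card_vertexSet {n : ℕ} {x : X _⦋n⦌} (h : x ∈ X.nonDegenerate n) :
    (E.vertexSet x).card = n + 1 := by
  rw [vertexSet, Finset.card_image_of_injective _ (E.injective_of_nonDegenerate h)]
  simp

theorem vert_eq_orderEmbOfFin {n : ℕ} {x : X _⦋n⦌} (h : x ∈ X.nonDegenerate n) {S : Finset V}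
    (hS : E.vertexSet x = S) (hc : S.card = n + 1) (i) : E.vert x i = S.orderEmbOfFin hc i := by
  refine congrFun (Finset.orderEmbOfFin_unique hc (f := E.vert x) (fun i => ?_) ?_) i
  · rw [← hS]
    exact Finset.mem_image_of_mem _ (Finset.mem_univ i)
  · exact (E.vert x).monotone.strictMono_of_injective (E.injective_of_nonDegenerate h)

theorem mk_eq_mk_iff {n m : ℕ} {x : X _⦋n⦌} {y : X _⦋m⦌} (hx : x ∈ X.nonDegenerate n)
    (hy : y ∈ X.nonDegenerate m) : SSet.S.mk x = SSet.S.mk y ↔ E.vertexSet x = E.vertexSet y := by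
  refine ⟨fun h => congrArg (fun s : X.S => E.vertexSet s.simplex) h, fun h => ?_⟩
  obtain rfl : n = m := by
    have h₁ := E.card_vertexSet hx
    have h₂ := E.card_vertexSet hy
    rw [h] at h₁
    omega
  obtain rfl : x = y := E.vert_injective fun i => by
    rw [E.vert_eq_orderEmbOfFin hx h (E.card_vertexSet hy),
      E.vert_eq_orderEmbOfFin hy rfl (E.card_vertexSet hy)]
  rfl

/-- Data on the subsets of `V` that defines an inner regular pairing of the simplices that are
not in a subcomplex `A`: every face `S` outside `A` has a corner, which is neither its smallest nor
its largest vertex, and the faces with and without this corner are matched. The weight certifies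
that the pairing is regular. -/
structure CornerData (A : X.Subcomplex) where
  Outside : Finset V → Prop
  notMem_iff : ∀ {n : ℕ} (x : X _⦋n⦌), x ∉ A.obj _ ↔ Outside (E.vertexSet x)
  corner : Finset V → V
  outside_insert : ∀ {S : Finset V}, E.IsFace S → Outside S → Outside (insert (corner S) S)
  isFace_insert : ∀ {S : Finset V}, E.IsFace S → Outside S → E.IsFace (insert (corner S) S)
  corner_insert : ∀ {S : Finset V}, E.IsFace S → Outside S → corner (insert (corner S) S) = corner S
  outside_erase : ∀ {S : Finset V}, E.IsFace S → Outside S → Outside (S.erase (corner S))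
  corner_erase : ∀ {S : Finset V}, E.IsFace S → Outside S → corner (S.erase (corner S)) = corner S
  exists_lt : ∀ {S : Finset V}, E.IsFace S → Outside S → ∃ a ∈ S, a < corner S
  exists_gt : ∀ {S : Finset V}, E.IsFace S → Outside S → ∃ a ∈ S, corner S < a
  weight : V → ℕ
  weight_lt : ∀ {S : Finset V} {z : V}, E.IsFace S → Outside S → corner S ∈ S → z ∈ S →
    z ≠ corner S → corner (S.erase z) ∉ S.erase z → weight (corner S) < weight z

namespace CornerData

variable {E} {A : X.Subcomplex} (D : E.CornerData A)

/-- The pairs of the pairing: a pair is indexed by the larger face, the one that contains its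
corner. -/
structure Index where
  dim : ℕ
  set : Finset V
  card_eq : set.card = dim + 2
  isFace : E.IsFace set
  outside : D.Outside set
  mem : D.corner set ∈ set

variable {D}

theorem Index.ext_set {s t : D.Index} (h : s.set = t.set) : s = t := by
  obtain ⟨d, S, hc, _, _, _⟩ := s
  obtain ⟨d', S', hc', _, _, _⟩ := t
  subst h
  obtain rfl : d = d' := by dsimp at hc hc'; omega
  rfl

/-- The larger simplex of a pair. -/
def Index.simplex (s : D.Index) : X _⦋s.dim + 1⦌ :=
  (E.exists_simplex s.set s.card_eq s.isFace).choose

theorem Index.vert_simplex (s : D.Index) (i) :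
    E.vert s.simplex i = s.set.orderEmbOfFin s.card_eq i :=
  (E.exists_simplex s.set s.card_eq s.isFace).choose_spec i

theorem Index.vertexSet_simplex (s : D.Index) : E.vertexSet s.simplex = s.set := by
  rw [vertexSet, show (E.vert s.simplex : Fin _ → V) = _ from funext s.vert_simplex]
  exact Finset.image_orderEmbOfFin_univ _ _

theorem Index.injective_vert (s : D.Index) : Function.Injective (E.vert s.simplex) := by
  intro i j h
  rw [s.vert_simplex, s.vert_simplex] at h
  exact (s.set.orderEmbOfFin s.card_eq).injective h

theorem Index.simplex_nonDegenerate (s : D.Index) : s.simplex ∈ X.nonDegenerate (s.dim + 1) :=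
  E.nonDegenerate_of_injective s.injective_vert

theorem Index.exists_index (s : D.Index) :
    ∃ i, E.vert s.simplex i = D.corner s.set := by
  have h := s.mem
  rw [← s.vertexSet_simplex] at h
  obtain ⟨i, -, hi⟩ := Finset.mem_image.1 h
  refine ⟨i, hi.trans ?_⟩
  rw [s.vertexSet_simplex]

/-- The position of the corner among the vertices of the larger simplex of a pair. -/
def Index.index (s : D.Index) : Fin (s.dim + 2) := s.exists_index.choose

theorem Index.vert_index (s : D.Index) : E.vert s.simplex s.index = D.corner s.set :=
  s.exists_index.choose_spec

theorem Index.vert_δ (s : D.Index) (i : Fin (s.dim + 2)) (j : Fin (s.dim + 1)) :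
    E.vert (X.δ i s.simplex) j = E.vert s.simplex (i.succAbove j) :=
  E.vert_map _ _ _

theorem Index.δ_nonDegenerate (s : D.Index) (i : Fin (s.dim + 2)) :
    X.δ i s.simplex ∈ X.nonDegenerate s.dim := by
  refine E.nonDegenerate_of_injective fun j k h => ?_
  rw [s.vert_δ, s.vert_δ] at h
  exact Fin.succAbove_right_injective (s.injective_vert h)

theorem Index.vertexSet_δ (s : D.Index) (i : Fin (s.dim + 2)) :
    E.vertexSet (X.δ i s.simplex) = s.set.erase (E.vert s.simplex i) := by
  ext v
  rw [← s.vertexSet_simplex, Finset.mem_erase]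
  simp only [vertexSet, Finset.mem_image, Finset.mem_univ, true_and]
  constructor
  · rintro ⟨j, rfl⟩
    rw [s.vert_δ]
    exact ⟨fun h => Fin.succAbove_ne _ _ (s.injective_vert h), _, rfl⟩
  · rintro ⟨hv, j, rfl⟩
    obtain ⟨k, rfl⟩ := Fin.exists_succAbove_eq (x := j) (y := i) (fun h => hv (by rw [h]))
    exact ⟨k, s.vert_δ i k⟩

theorem Index.vertexSet_δ_index (s : D.Index) :
    E.vertexSet (X.δ s.index s.simplex) = s.set.erase (D.corner s.set) := by
  rw [s.vertexSet_δ, s.vert_index]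

theorem Index.ext_of_erase {s t : D.Index}
    (h : s.set.erase (D.corner s.set) = t.set.erase (D.corner t.set)) : s = t := by
  have h' : D.corner s.set = D.corner t.set := by
    rw [← D.corner_erase s.isFace s.outside, h, D.corner_erase t.isFace t.outside]
  refine Index.ext_set ?_
  rw [← Finset.insert_erase s.mem, h, h', Finset.insert_erase t.mem]

theorem Index.eq_of_δ_eq (s : D.Index) {i j : Fin (s.dim + 2)}
    (hij : X.δ i s.simplex = X.δ j s.simplex) : i = j := by
  refine s.injective_vert ?_
  have h : s.set.erase (E.vert s.simplex i) = s.set.erase (E.vert s.simplex j) := by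
    rw [← s.vertexSet_δ, ← s.vertexSet_δ, hij]
  have hi' : E.vert s.simplex i ∈ s.set := by
    rw [s.vert_simplex]
    exact Finset.orderEmbOfFin_mem _ _ _
  by_contra hne
  have := Finset.mem_erase.2 ⟨hne, hi'⟩
  rw [← h] at this
  exact Finset.notMem_erase _ _ this

theorem Index.sum_weight_lt {s t : D.Index} (hne : s ≠ t) (hd : s.dim = t.dim)
    (hsub : s.set.erase (D.corner s.set) ⊆ t.set) :
    ∑ x ∈ s.set.erase (D.corner s.set), D.weight x <
      ∑ x ∈ t.set.erase (D.corner t.set), D.weight x := by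
  have hc := Finset.card_erase_of_mem s.mem
  have hcs := s.card_eq
  have hct := t.card_eq
  obtain ⟨z, hz, hz'⟩ := Finset.exists_mem_notMem_of_card_lt_card
    (s := s.set.erase (D.corner s.set)) (t := t.set) (by omega)
  have heq : s.set.erase (D.corner s.set) = t.set.erase z := by
    refine Finset.eq_of_subset_of_card_le
      (fun a ha => Finset.mem_erase.2 ⟨fun h => hz' (h ▸ ha), hsub ha⟩) ?_
    rw [Finset.card_erase_of_mem hz]
    omega
  have hzu : z ≠ D.corner t.set := by
    rintro rfl
    exact hne (Index.ext_of_erase heq)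
  have hlt' := D.weight_lt t.isFace t.outside t.mem hz hzu
    (by rw [← heq, D.corner_erase s.isFace s.outside]
        exact Finset.notMem_erase _ _)
  have h₁ := Finset.add_sum_erase _ D.weight hz
  have h₂ := Finset.add_sum_erase _ D.weight t.mem
  rw [heq]
  omega

theorem exists_index_of_corner_mem {n : ℕ} {x : X _⦋n⦌} (hx : x ∈ X.nonDegenerate n)
    (hA : x ∉ A.obj _) (hcorner : D.corner (E.vertexSet x) ∈ E.vertexSet x) :
    ∃ s : D.Index, SSet.S.mk x = SSet.S.mk s.simplex := by
  have hface : E.IsFace (E.vertexSet x) := E.isFace_image_vert x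
  have hout := (D.notMem_iff x).1 hA
  obtain ⟨a, ha, ha'⟩ := D.exists_lt hface hout
  have : 1 < (E.vertexSet x).card := Finset.one_lt_card.2 ⟨a, ha, _, hcorner, ha'.ne⟩
  refine ⟨⟨(E.vertexSet x).card - 2, _, by omega, hface, hout, hcorner⟩, ?_⟩
  rw [E.mk_eq_mk_iff hx (Index.simplex_nonDegenerate _), Index.vertexSet_simplex]

theorem exists_index_of_corner_notMem {n : ℕ} {x : X _⦋n⦌} (hx : x ∈ X.nonDegenerate n)
    (hA : x ∉ A.obj _) (hcorner : D.corner (E.vertexSet x) ∉ E.vertexSet x) :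
    ∃ s : D.Index, SSet.S.mk x = SSet.S.mk (X.δ s.index s.simplex) := by
  have hface : E.IsFace (E.vertexSet x) := E.isFace_image_vert x
  have hout := (D.notMem_iff x).1 hA
  refine ⟨⟨n, insert (D.corner (E.vertexSet x)) (E.vertexSet x), ?_, D.isFace_insert hface hout,
    D.outside_insert hface hout, ?_⟩, ?_⟩
  · rw [Finset.card_insert_of_notMem hcorner, E.card_vertexSet hx]
  · rw [D.corner_insert hface hout]
    exact Finset.mem_insert_self _ _
  · rw [E.mk_eq_mk_iff hx (Index.δ_nonDegenerate _ _), Index.vertexSet_δ_index]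
    dsimp only
    rw [D.corner_insert hface hout, Finset.erase_insert hcorner]

variable (D)

/-- The pairing that matches the faces outside `A` with and without their corner. -/
def pairingCore : A.PairingCore where
  ι := D.Index
  dim s := s.dim
  simplex s := s.simplex
  index s := s.index
  nonDegenerate₁ s := s.simplex_nonDegenerate
  nonDegenerate₂ s := s.δ_nonDegenerate _
  notMem₁ s := by
    rw [D.notMem_iff, s.vertexSet_simplex]
    exact s.outside
  notMem₂ s := by
    rw [D.notMem_iff, s.vertexSet_δ_index]
    exact D.outside_erase s.isFace s.outside
  injective_type₁' {s t} h := by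
    rw [E.mk_eq_mk_iff s.simplex_nonDegenerate
      t.simplex_nonDegenerate, s.vertexSet_simplex, t.vertexSet_simplex] at h
    exact Index.ext_set h
  injective_type₂' {s t} h := by
    rw [E.mk_eq_mk_iff (s.δ_nonDegenerate _)
      (t.δ_nonDegenerate _), s.vertexSet_δ_index, t.vertexSet_δ_index] at h
    exact Index.ext_of_erase h
  type₁_ne_type₂' s t h := by
    rw [E.mk_eq_mk_iff s.simplex_nonDegenerate
      (t.δ_nonDegenerate _), s.vertexSet_simplex, t.vertexSet_δ_index] at h
    have h' := s.mem
    rw [h, D.corner_erase t.isFace t.outside] at h'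
    exact Finset.notMem_erase _ _ h'
  surjective' x := by
    by_cases hcorner : D.corner (E.vertexSet x.simplex) ∈ E.vertexSet x.simplex
    · obtain ⟨s, hs⟩ := exists_index_of_corner_mem x.nonDegenerate x.notMem hcorner
      exact ⟨s, Or.inl hs⟩
    · obtain ⟨s, hs⟩ := exists_index_of_corner_notMem x.nonDegenerate x.notMem hcorner
      exact ⟨s, Or.inr hs⟩

instance : D.pairingCore.IsProper where
  isUniquelyCodimOneFace s := by
    exact (SSet.S.IsUniquelyCodimOneFace.iff _ _).2 ⟨_, rfl, fun i hi => Index.eq_of_δ_eq s hi⟩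

instance : D.pairingCore.IsInner where
  ne_zero (s : D.Index) h := by
    obtain ⟨a, ha, ha'⟩ := D.exists_lt s.isFace s.outside
    rw [← s.vertexSet_simplex] at ha
    obtain ⟨i, -, rfl⟩ := Finset.mem_image.1 ha
    rw [← s.vert_index] at ha'
    have : s.index = 0 := h
    rw [this] at ha'
    exact absurd ((E.vert _).monotone (Fin.zero_le i)) (not_le.2 ha')
  ne_last (s : D.Index) h := by
    obtain ⟨a, ha, ha'⟩ := D.exists_gt s.isFace s.outside
    rw [← s.vertexSet_simplex] at ha
    obtain ⟨i, -, rfl⟩ := Finset.mem_image.1 ha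
    rw [← s.vert_index] at ha'
    have : s.index = Fin.last _ := h
    rw [this] at ha'
    exact absurd ((E.vert _).monotone (Fin.le_last i)) (not_le.2 ha')

/-- The rank of a pair: the total weight of the vertices of its smaller simplex. -/
def weakRankFunction : D.pairingCore.WeakRankFunction ℕ where
  rank (s : D.Index) := ∑ x ∈ s.set.erase (D.corner s.set), D.weight x
  lt {s t} hst hd := by
    obtain ⟨f, hf⟩ := SSet.S.le_iff.1 (show (D.pairingCore.type₂ s).toS ≤
      (D.pairingCore.type₁ t).toS from hst.2.le)
    refine Index.sum_weight_lt hst.1 hd ?_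
    refine (Index.vertexSet_δ_index s).symm.subset.trans (Finset.Subset.trans ?_
      (Index.vertexSet_simplex t).subset)
    exact (congrArg E.vertexSet hf).symm.subset.trans (E.vertexSet_map_subset f (Index.simplex t))

theorem innerAnodyneExtensions (D : E.CornerData A) : SSet.innerAnodyneExtensions A.ι :=
  have : D.pairingCore.IsRegular := D.weakRankFunction.isRegular
  D.pairingCore.pairing.innerAnodyneExtensions

end CornerData

end VertexModel

/-! ### Corners in generalized joins of simplices -/

/-- A vertex of the generalized join of `Δ[n]` and `Δ[m]`: its image in `Δ[r]` and its components
in `Δ[n]` and `Δ[m]`, a component being `0` where it is not defined. The order is lexicographic. -/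
@[ext]
structure JoinVertex where
  base : ℕ
  left : ℕ
  right : ℕ

namespace JoinVertex

instance : LinearOrder JoinVertex :=
  LinearOrder.lift' (fun v => toLex (v.base, toLex (v.left, v.right))) (by
    rintro ⟨c, k, w⟩ ⟨c', k', w'⟩ h
    have h' := congrArg ofLex h
    simp only [ofLex_toLex, Prod.mk.injEq, EmbeddingLike.apply_eq_iff_eq] at h'
    obtain ⟨rfl, rfl, rfl⟩ := h'
    rfl)

theorem le_iff {a b : JoinVertex} :
    a ≤ b ↔ a.base < b.base ∨
      a.base = b.base ∧ (a.left < b.left ∨ a.left = b.left ∧ a.right ≤ b.right) := by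
  change toLex (a.base, toLex (a.left, a.right)) ≤ toLex (b.base, toLex (b.left, b.right)) ↔ _
  simp only [Prod.Lex.toLex_le_toLex]

theorem lt_of_base_lt {a b : JoinVertex} (h : a.base < b.base) : a < b :=
  lt_of_not_ge fun h' => by
    rw [le_iff] at h'
    omega

/-- The sets of vertices of the simplices of the generalized join of `Δ[n]` and `Δ[m]` whose left
part is the complement of `0` and whose right part is given by `hasRight`. -/
structure IsFace (r n m : ℕ) (hasRight : ℕ → Prop) (S : Finset JoinVertex) : Prop where
  base_le : ∀ x ∈ S, x.base ≤ r
  left_le : ∀ x ∈ S, x.left ≤ n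
  right_le : ∀ x ∈ S, x.right ≤ m
  left_eq : ∀ x ∈ S, x.base = 0 → x.left = 0
  right_eq : ∀ x ∈ S, ¬ hasRight x.base → x.right = 0
  left_mono : ∀ x ∈ S, ∀ y ∈ S, x ≤ y → x.left ≤ y.left
  right_mono : ∀ x ∈ S, ∀ y ∈ S, x ≤ y → hasRight x.base → hasRight y.base → x.right ≤ y.right

/-- A set of vertices meets the parts over `0` and over `{2, …, r}`, and it maps onto the vertices
of `Δ[n]` and of `Δ[m]`. -/
structure IsFull (n m : ℕ) (hasRight : ℕ → Prop) (S : Finset JoinVertex) : Prop where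
  zero : ∃ x ∈ S, x.base = 0
  two : ∃ x ∈ S, 2 ≤ x.base
  left_surj : ∀ k ≤ n, ∃ x ∈ S, x.base ≠ 0 ∧ x.left = k
  right_surj : ∀ w ≤ m, ∃ x ∈ S, hasRight x.base ∧ x.right = w

/-- The least left component over `{2, …, r}`. -/
def minLeft (S : Finset JoinVertex) : ℕ := sInf {k | ∃ b ∈ S, 2 ≤ b.base ∧ b.left = k}

/-- The largest right component among the vertices before the corner. -/
def maxRight (S : Finset JoinVertex) : ℕ :=
  (S.filter fun x => x.base = 0 ∨ x.base = 1 ∧ x.left < minLeft S).sup right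

open Classical in
/-- The vertex over `1` that is added or removed in order to match simplices: it has the largest
left component and the least right component for which adding it preserves monotonicity. -/
def corner (hasRight : ℕ → Prop) (S : Finset JoinVertex) : JoinVertex :=
  ⟨1, minLeft S, if hasRight 1 then maxRight S else 0⟩

variable {r n m : ℕ} {hasRight : ℕ → Prop} {S S' : Finset JoinVertex}

theorem corner_congr (h₂ : ∀ x, 2 ≤ x.base → (x ∈ S ↔ x ∈ S'))
    (h₁ : ∀ x, (x.base = 0 ∨ x.base = 1 ∧ x.left < minLeft S) → (x ∈ S ↔ x ∈ S')) :
    corner hasRight S = corner hasRight S' := by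
  have hk : minLeft S = minLeft S' := by
    refine congrArg sInf (Set.ext fun k => exists_congr fun b => ?_)
    exact and_congr_left fun hb => h₂ b hb.1
  have hw : maxRight S = maxRight S' := by
    rw [maxRight, maxRight, ← hk]
    refine congrArg (fun F : Finset JoinVertex => F.sup right) (Finset.ext fun x => ?_)
    rw [Finset.mem_filter, Finset.mem_filter]
    exact and_congr_left (h₁ x)
  rw [corner, corner, hk, hw]

theorem minLeft_le {b : JoinVertex} (hb : b ∈ S) (hb' : 2 ≤ b.base) : minLeft S ≤ b.left :=
  Nat.sInf_le ⟨b, hb, hb', rfl⟩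

theorem IsFull.exists_minLeft (h : IsFull n m hasRight S) :
    ∃ b ∈ S, 2 ≤ b.base ∧ b.left = minLeft S := by
  obtain ⟨b, hb, hb'⟩ := h.two
  exact Nat.sInf_mem (s := {k | ∃ b ∈ S, 2 ≤ b.base ∧ b.left = k}) ⟨_, b, hb, hb', rfl⟩

theorem le_maxRight {x : JoinVertex} (hx : x ∈ S)
    (hx' : x.base = 0 ∨ x.base = 1 ∧ x.left < minLeft S) : x.right ≤ maxRight S :=
  Finset.le_sup (f := right) (Finset.mem_filter.2 ⟨hx, hx'⟩)

theorem IsFull.exists_maxRight (h : IsFull n m hasRight S) :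
    ∃ x ∈ S, (x.base = 0 ∨ x.base = 1 ∧ x.left < minLeft S) ∧ x.right = maxRight S := by
  obtain ⟨a, ha, ha'⟩ := h.zero
  obtain ⟨x, hx, hx'⟩ := Finset.exists_mem_eq_sup
    (S.filter fun x => x.base = 0 ∨ x.base = 1 ∧ x.left < minLeft S)
    ⟨a, Finset.mem_filter.2 ⟨ha, Or.inl ha'⟩⟩ JoinVertex.right
  rw [Finset.mem_filter] at hx
  exact ⟨x, hx.1, hx.2, hx'.symm⟩

theorem corner_right (h : hasRight 1) : (corner hasRight S).right = maxRight S := if_pos h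

theorem hasRight_of_before (h0 : hasRight 0) (h1 : hasRight 1) {x : JoinVertex} {k : ℕ}
    (hx : x.base = 0 ∨ x.base = 1 ∧ x.left < k) : hasRight x.base := by
  rcases hx with h | ⟨h, -⟩ <;> rwa [h]

theorem corner_right_of_not (h : ¬ hasRight 1) : (corner hasRight S).right = 0 := if_neg h

theorem IsFace.left_mono_insert_corner (hg : IsFace r n m hasRight S) {x y : JoinVertex}
    (hx : x ∈ insert (corner hasRight S) S) (hy : y ∈ insert (corner hasRight S) S) (hxy : x ≤ y) :
    x.left ≤ y.left := by
  have hc : (corner hasRight S).base = 1 := rfl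
  have hk : (corner hasRight S).left = minLeft S := rfl
  rcases Finset.mem_insert.1 hx with rfl | hx <;> rcases Finset.mem_insert.1 hy with rfl | hy
  · rfl
  · rw [le_iff] at hxy
    by_cases h2 : 2 ≤ y.base
    · exact minLeft_le hy h2
    · omega
  · rw [le_iff] at hxy
    by_cases h0 : x.base = 0
    · rw [hg.left_eq x hx h0]
      exact Nat.zero_le _
    · omega
  · exact hg.left_mono x hx y hy hxy

theorem IsFace.right_mono_insert_corner (h0 : hasRight 0) (hg : IsFace r n m hasRight S)
    (hf : IsFull n m hasRight S) {x y : JoinVertex} (hx : x ∈ insert (corner hasRight S) S)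
    (hy : y ∈ insert (corner hasRight S) S) (hxy : x ≤ y)
    (hx' : hasRight x.base) (hy' : hasRight y.base) : x.right ≤ y.right := by
  have hc : (corner hasRight S).base = 1 := rfl
  have hk : (corner hasRight S).left = minLeft S := rfl
  rcases Finset.mem_insert.1 hx with rfl | hx <;> rcases Finset.mem_insert.1 hy with rfl | hy
  · rfl
  · obtain ⟨p, hp, hpc, hpw⟩ := hf.exists_maxRight
    rw [corner_right hx', ← hpw]
    refine hg.right_mono p hp y hy ?_ (hasRight_of_before h0 hx' hpc) hy'
    rw [le_iff] at hxy ⊢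
    omega
  · rw [corner_right hy']
    by_cases hx₁ : x.base = 0 ∨ x.base = 1 ∧ x.left < minLeft S
    · exact le_maxRight hx hx₁
    · rw [le_iff, corner_right hy'] at hxy
      omega
  · exact hg.right_mono x hx y hy hxy hx' hy'

theorem IsFace.insert_corner (h0 : hasRight 0) (hg : IsFace r n m hasRight S)
    (hf : IsFull n m hasRight S) : IsFace r n m hasRight (insert (corner hasRight S) S) where
  base_le := by
    obtain ⟨b, hb, hbc, -⟩ := hf.exists_minLeft
    have one_le : 1 ≤ b.base := by omega
    exact (Finset.forall_mem_insert ..).2 ⟨one_le.trans (hg.base_le b hb), hg.base_le⟩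
  left_le := by
    obtain ⟨b, hb, -, hbk⟩ := hf.exists_minLeft
    exact (Finset.forall_mem_insert ..).2 ⟨hbk.ge.trans (hg.left_le b hb), hg.left_le⟩
  right_le := by
    refine (Finset.forall_mem_insert ..).2 ⟨?_, hg.right_le⟩
    by_cases h1 : hasRight 1
    · obtain ⟨p, hp, -, hpw⟩ := hf.exists_maxRight
      rw [corner_right h1, ← hpw]
      exact hg.right_le p hp
    · exact (corner_right_of_not h1).le.trans (Nat.zero_le m)
  left_eq := (Finset.forall_mem_insert ..).2 ⟨fun h => absurd h one_ne_zero, hg.left_eq⟩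
  right_eq := (Finset.forall_mem_insert ..).2 ⟨corner_right_of_not, hg.right_eq⟩
  left_mono _ hx _ hy hxy := hg.left_mono_insert_corner hx hy hxy
  right_mono _ hx _ hy hxy hx' hy' := hg.right_mono_insert_corner h0 hf hx hy hxy hx' hy'

theorem IsFull.mono (h : IsFull n m hasRight S) (hs : S ⊆ S') : IsFull n m hasRight S' where
  zero := h.zero.imp fun _ h => ⟨hs h.1, h.2⟩
  two := h.two.imp fun _ h => ⟨hs h.1, h.2⟩
  left_surj k hk := (h.left_surj k hk).imp fun _ h => ⟨hs h.1, h.2⟩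
  right_surj w hw := (h.right_surj w hw).imp fun _ h => ⟨hs h.1, h.2⟩

theorem ne_corner_of_base_ne {x : JoinVertex} (h : x.base ≠ 1) : x ≠ corner hasRight S := by
  rintro rfl
  exact h rfl

theorem ne_corner_of_left_lt {x : JoinVertex} (h : x.left < minLeft S) : x ≠ corner hasRight S := by
  rintro rfl
  exact lt_irrefl _ h

theorem IsFull.erase_corner (h0 : hasRight 0) (hf : IsFull n m hasRight S) :
    IsFull n m hasRight (S.erase (corner hasRight S)) where
  zero := hf.zero.imp fun _ h => ⟨Finset.mem_erase.2 ⟨ne_corner_of_base_ne (by omega), h.1⟩, h.2⟩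
  two := hf.two.imp fun _ h => ⟨Finset.mem_erase.2 ⟨ne_corner_of_base_ne (by omega), h.1⟩, h.2⟩
  left_surj k hk := by
    obtain ⟨x, hx, hxc, rfl⟩ := hf.left_surj k hk
    by_cases h : x = corner hasRight S
    · obtain ⟨b, hb, hbc, hbk⟩ := hf.exists_minLeft
      refine ⟨b, Finset.mem_erase.2 ⟨ne_corner_of_base_ne (by omega), hb⟩, by omega, ?_⟩
      rw [hbk, h]
      rfl
    · exact ⟨x, Finset.mem_erase.2 ⟨h, hx⟩, hxc, rfl⟩
  right_surj w hw := by
    obtain ⟨x, hx, hxc, rfl⟩ := hf.right_surj w hw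
    by_cases h : x = corner hasRight S
    · have h1 : hasRight 1 := by rwa [h] at hxc
      obtain ⟨p, hp, hpc, hpw⟩ := hf.exists_maxRight
      refine ⟨p, Finset.mem_erase.2 ⟨?_, hp⟩, ?_, ?_⟩
      · rcases hpc with hpc | hpc
        · exact ne_corner_of_base_ne (by omega)
        · exact ne_corner_of_left_lt hpc.2
      · exact hasRight_of_before h0 h1 hpc
      · rw [hpw, h, corner_right h1]
    · exact ⟨x, Finset.mem_erase.2 ⟨h, hx⟩, hxc, rfl⟩

theorem corner_insert_corner :
    corner hasRight (insert (corner hasRight S) S) = corner hasRight S := by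
  refine (corner_congr (fun x hx => ?_) fun x hx => ?_).symm <;> rw [Finset.mem_insert]
  · exact (or_iff_right (ne_corner_of_base_ne (by omega))).symm
  · refine (or_iff_right ?_).symm
    rcases hx with hx | hx
    · exact ne_corner_of_base_ne (by omega)
    · exact ne_corner_of_left_lt hx.2

theorem corner_erase {z : JoinVertex} (hz : z.base = 1) (hz' : minLeft S ≤ z.left) :
    corner hasRight (S.erase z) = corner hasRight S := by
  refine (corner_congr (fun x hx => ?_) fun x hx => ?_).symm <;> rw [Finset.mem_erase]
  · refine (and_iff_right ?_).symm
    rintro rfl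
    omega
  · refine (and_iff_right ?_).symm
    rintro rfl
    omega

/-- Removing a vertex other than the corner changes the corner only if the vertex has smaller
left component or does not lie over `1`, and these vertices are given larger weight. -/
def weight (n : ℕ) (x : JoinVertex) : ℕ := if x.base = 1 then n - x.left else n + 1

theorem weight_lt (hg : IsFace r n m hasRight S) (hf : IsFull n m hasRight S) {z : JoinVertex}
    (hu : corner hasRight S ∈ S) (hz : z ∈ S) (hne : z ≠ corner hasRight S)
    (h : corner hasRight (S.erase z) ∉ S.erase z) :
    weight n (corner hasRight S) < weight n z := by
  have hw : weight n (corner hasRight S) = n - minLeft S := rfl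
  obtain ⟨b, hb, hbc, hbk⟩ := hf.exists_minLeft
  have hbn := hg.left_le b hb
  have hzn := hg.left_le z hz
  rw [hw, weight]
  split_ifs with hc
  · by_contra hlt
    rw [corner_erase hc (by omega)] at h
    exact h (Finset.mem_erase.2 ⟨hne.symm, hu⟩)
  · omega

end JoinVertex

/-- The vertex `i` of a standard simplex, as a `0`-simplex. -/
def simplexVertex (N : SimplexCategory) (i : Fin (N.len + 1)) :
    (SSet.stdSimplex.obj N : SSet.{u}).obj (op ⦋0⦌) :=
  SSet.stdSimplex.objEquiv.symm (SimplexCategory.const ⦋0⦌ N i)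

section

variable {r : ℕ} {N : SimplexCategory} {χ : SSet.stdSimplex.{u}.obj N ⟶ Δ[r]}
  {U : Finset (Fin (r + 1))} {n : ℕ}

theorem simplexVertex_mem_part {i : Fin (N.len + 1)} (hi : vertexOf (SSet.yonedaEquiv χ) i ∈ U) :
    simplexVertex N i ∈ (part χ U).obj (op ⦋0⦌) :=
  (mem_part_iff χ U _).2 fun _ => hi

open Classical in
/-- The vertices of a map from a part of a standard simplex to a standard simplex. -/
def partVertex (l : (part χ U : SSet.{u}) ⟶ Δ[n]) (i : Fin (N.len + 1)) : ℕ :=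
  if hi : vertexOf (SSet.yonedaEquiv χ) i ∈ U then
    (vertexOf (l.app (op ⦋0⦌) ⟨simplexVertex N i, simplexVertex_mem_part hi⟩) 0).val else 0

theorem partVertex_of_notMem (l : (part χ U : SSet.{u}) ⟶ Δ[n]) {i : Fin (N.len + 1)}
    (hi : vertexOf (SSet.yonedaEquiv χ) i ∉ U) : partVertex l i = 0 := dif_neg hi

theorem vertexOf_app_part (l : (part χ U : SSet.{u}) ⟶ Δ[n]) {k : SimplexCategoryᵒᵖ}
    (x : (part χ U : SSet.{u}).obj k) (i : Fin (k.unop.len + 1)) :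
    (vertexOf (l.app k x) i).val = partVertex l (vertexOf x.1 i) := by
  have hi := (mem_part_iff χ U _).1 x.2 i
  rw [partVertex, dif_pos hi]
  have naturality := NatTrans.naturality_apply l (SimplexCategory.const ⦋0⦌ k.unop i).op x
  have vertex_eq : (part χ U : SSet.{u}).map (SimplexCategory.const ⦋0⦌ k.unop i).op x =
      ⟨simplexVertex N (vertexOf x.1 i), simplexVertex_mem_part hi⟩ :=
    Subtype.ext (vertexOf_ext fun _ => rfl)
  rw [vertex_eq] at naturality
  rw [naturality]
  rfl

theorem partVertex_le (l : (part χ U : SSet.{u}) ⟶ Δ[n]) (i : Fin (N.len + 1)) :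
    partVertex l i ≤ n := by
  rw [partVertex]
  split_ifs
  · exact Fin.is_le _
  · exact Nat.zero_le _

theorem partVertex_mono (l : (part χ U : SSet.{u}) ⟶ Δ[n]) {i j : Fin (N.len + 1)} (hij : i ≤ j)
    (hi : vertexOf (SSet.yonedaEquiv χ) i ∈ U) (hj : vertexOf (SSet.yonedaEquiv χ) j ∈ U) :
    partVertex l i ≤ partVertex l j := by
  let e : (SSet.stdSimplex.obj N : SSet.{u}).obj (op ⦋1⦌) :=
    SSet.stdSimplex.objEquiv.symm (SimplexCategory.mkOfLe i j hij)
  have he : e ∈ (part χ U).obj (op ⦋1⦌) := by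
    rw [mem_part_iff, Fin.forall_fin_two]
    exact ⟨hi, hj⟩
  have h₀ := vertexOf_app_part l ⟨e, he⟩ 0
  have h₁ := vertexOf_app_part l ⟨e, he⟩ 1
  refine h₀.symm.le.trans (le_trans ?_ h₁.le)
  exact vertexOf_monotone (l.app (op ⦋1⦌) ⟨e, he⟩) (Fin.zero_le 1)

theorem part_hom_ext {l l' : (part χ U : SSet.{u}) ⟶ Δ[n]}
    (h : ∀ i, vertexOf (SSet.yonedaEquiv χ) i ∈ U → partVertex l i = partVertex l' i) : l = l' := by
  refine NatTrans.ext (funext fun k => ConcreteCategory.hom_ext _ _ fun x => ?_)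
  refine vertexOf_ext (n := ⦋n⦌) fun i => Fin.ext ?_
  rw [vertexOf_app_part, vertexOf_app_part]
  exact h _ ((mem_part_iff χ U _).1 x.2 i)

theorem partVertex_precomp {N' : SimplexCategory} (f : N' ⟶ N)
    (l : (part χ U : SSet.{u}) ⟶ Δ[n]) (i : Fin (N'.len + 1)) :
    partVertex (partMap (SSet.stdSimplex.map f) χ U ≫ l) i = partVertex l (f.toOrderHom i) := by
  have h := vertexOf_yonedaEquiv_comp f χ i
  by_cases hi : vertexOf (SSet.yonedaEquiv χ) (f.toOrderHom i) ∈ U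
  · rw [partVertex, dif_pos (by rwa [h]), partVertex, dif_pos hi]
    rfl
  · rw [partVertex, dif_neg (by rwa [h]), partVertex, dif_neg hi]

theorem exists_part_hom (g : Fin (N.len + 1) → ℕ)
    (hg : ∀ i, vertexOf (SSet.yonedaEquiv χ) i ∈ U → g i ≤ n)
    (hg' : ∀ i j, i ≤ j → vertexOf (SSet.yonedaEquiv χ) i ∈ U →
      vertexOf (SSet.yonedaEquiv χ) j ∈ U → g i ≤ g j) :
    ∃ l : (part χ U : SSet.{u}) ⟶ Δ[n],
      ∀ i, vertexOf (SSet.yonedaEquiv χ) i ∈ U → partVertex l i = g i := by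
  have hU {k : SimplexCategoryᵒᵖ} (x : (part χ U : SSet.{u}).obj k) (i : Fin (k.unop.len + 1)) :
      vertexOf (SSet.yonedaEquiv χ) (vertexOf x.1 i) ∈ U := (mem_part_iff χ U _).1 x.2 i
  let l : (part χ U : SSet.{u}) ⟶ Δ[n] :=
    { app k := ↾fun x => SSet.stdSimplex.objEquiv.symm (SimplexCategory.mkHom
        { toFun := fun i => ⟨g (vertexOf x.1 i), Nat.lt_succ_of_le (hg _ (hU x i))⟩
          monotone' := fun i j hij => hg' _ _ (vertexOf_monotone _ hij) (hU x i) (hU x j) })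
      naturality k k' f := by
        refine ConcreteCategory.hom_ext _ _ fun x => ?_
        exact vertexOf_ext (n := ⦋n⦌) fun i => rfl }
  refine ⟨l, fun i hi => ?_⟩
  rw [partVertex, dif_pos hi]
  rfl

theorem mem_boundary_iff {k : SimplexCategoryᵒᵖ} (x : (Δ[n] : SSet.{u}).obj k) :
    x ∈ (SSet.boundary n).obj k ↔ ∃ v ≤ n, ∀ i, (vertexOf (n := ⦋n⦌) x i).val ≠ v := by
  have h : x ∈ (SSet.boundary n).obj k ↔ ¬ Function.Surjective (vertexOf (n := ⦋n⦌) x) := Iff.rfl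
  rw [h, Function.Surjective]
  push Not
  constructor
  · rintro ⟨b, hb⟩
    exact ⟨b.val, Nat.lt_succ_iff.1 b.isLt, fun i hi => hb i (Fin.ext hi)⟩
  · rintro ⟨v, hv, h⟩
    exact ⟨⟨v, Nat.lt_succ_of_le hv⟩, fun i hi => h i (congrArg Fin.val hi)⟩

theorem exists_simplex_part {i₀ : Fin (N.len + 1)} (h₀ : vertexOf (SSet.yonedaEquiv χ) i₀ ∈ U) :
    ∃ y : (part χ U : SSet.{u}).obj (op N),
      ∀ i, vertexOf (SSet.yonedaEquiv χ) i ∈ U → vertexOf y.1 i = i := by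
  obtain ⟨a, ha⟩ := exists_retraction_part h₀
  refine ⟨a.app (op N) (SSet.stdSimplex.objEquiv.symm (𝟙 N)), fun i hi => ?_⟩
  have fixed : (a.app (op ⦋0⦌) (simplexVertex N i)).1 = simplexVertex N i :=
    congrArg Subtype.val (ConcreteCategory.congr_hom (NatTrans.congr_app ha (op ⦋0⦌))
      ⟨simplexVertex N i, simplexVertex_mem_part hi⟩)
  have vertex_top := vertexOf_app (a ≫ (part χ U).ι) (SSet.stdSimplex.objEquiv.symm (𝟙 N)) i
  have vertex_fixed := vertexOf_app (a ≫ (part χ U).ι) (simplexVertex N i) 0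
  exact vertex_top.trans (vertex_fixed.symm.trans (congrArg (fun z => vertexOf z 0) fixed))

theorem forall_mem_boundary_iff (l : (part χ U : SSet.{u}) ⟶ Δ[n]) :
    (∀ k x, l.app k x ∈ (SSet.boundary n).obj k) ↔
      ∃ v ≤ n, ∀ i, vertexOf (SSet.yonedaEquiv χ) i ∈ U → partVertex l i ≠ v := by
  constructor
  · intro h
    by_cases hne : ∃ i₀, vertexOf (SSet.yonedaEquiv χ) i₀ ∈ U
    · obtain ⟨i₀, h₀⟩ := hne
      obtain ⟨y, hy⟩ := exists_simplex_part h₀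
      obtain ⟨v, hv, hv'⟩ := (mem_boundary_iff _).1 (h _ y)
      refine ⟨v, hv, fun i hi => ?_⟩
      rw [← hy i hi, ← vertexOf_app_part]
      exact hv' i
    · push Not at hne
      exact ⟨0, Nat.zero_le n, fun i hi => absurd hi (hne i)⟩
  · rintro ⟨v, hv, h⟩ k x
    refine (mem_boundary_iff _).2 ⟨v, hv, fun i => ?_⟩
    rw [vertexOf_app_part]
    exact h _ ((mem_part_iff χ U _).1 x.2 i)

end

section

variable {r : ℕ} {S : Finset (Fin (r + 1))} {n m : ℕ}

/-- Membership in a set of vertices of `Δ[r]`, for vertices given as natural numbers as in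
`JoinVertex.base`. -/
def IsValIn (S : Finset (Fin (r + 1))) (c : ℕ) : Prop :=
  ∃ h : c < r + 1, (⟨c, h⟩ : Fin (r + 1)) ∈ S

theorem isValIn_val {i : Fin (r + 1)} : IsValIn S i.val ↔ i ∈ S :=
  ⟨fun ⟨_, h⟩ => h, fun h => ⟨i.isLt, h⟩⟩

theorem mem_zero_compl_iff {i : Fin (r + 1)} : i ∈ ({0}ᶜ : Finset (Fin (r + 1))) ↔ i.val ≠ 0 := by
  rw [Finset.mem_compl, Finset.mem_singleton, Fin.ext_iff]
  rfl

variable {N : SimplexCategory}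

/-- The vertices of a simplex of a generalized join of standard simplices. -/
def PartsData.joinVertex (d : PartsData {0}ᶜ S (SSet.stdSimplex.{u}.obj N) Δ[n] Δ[m])
    (i : Fin (N.len + 1)) : JoinVertex :=
  ⟨(d.vertex i).val, partVertex d.left i, partVertex d.right i⟩

variable (d : PartsData {0}ᶜ S (SSet.stdSimplex.{u}.obj N) Δ[n] Δ[m])

theorem PartsData.vertex_mono {i j : Fin (N.len + 1)} (hij : i ≤ j) : d.vertex i ≤ d.vertex j :=
  vertexOf_monotone _ hij

theorem PartsData.left_mono {i j : Fin (N.len + 1)} (hij : i ≤ j) :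
    partVertex d.left i ≤ partVertex d.left j := by
  by_cases hi : d.vertex i ∈ ({0}ᶜ : Finset (Fin (r + 1)))
  · refine partVertex_mono _ hij hi ?_
    have : d.vertex j ∈ ({0}ᶜ : Finset (Fin (r + 1))) := by
      rw [mem_zero_compl_iff] at hi ⊢
      have := Fin.le_def.1 (d.vertex_mono hij)
      omega
    exact this
  · exact (partVertex_of_notMem d.left hi).trans_le (Nat.zero_le _)

theorem PartsData.joinVertex_mono : Monotone d.joinVertex := by
  intro i j hij
  rw [JoinVertex.le_iff]
  have h₁ := Fin.le_def.1 (d.vertex_mono hij)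
  have h₂ := d.left_mono hij
  by_cases h : d.vertex i = d.vertex j
  · refine Or.inr ⟨congrArg Fin.val h, ?_⟩
    have h₃ : partVertex d.right i ≤ partVertex d.right j := by
      by_cases hi : d.vertex i ∈ S
      · exact partVertex_mono _ hij hi (h ▸ hi : d.vertex j ∈ S)
      · exact (partVertex_of_notMem d.right hi).trans_le (Nat.zero_le _)
    change partVertex d.left i < partVertex d.left j ∨ partVertex d.left i = partVertex d.left j ∧ _
    rcases h₂.lt_or_eq with h₂ | h₂
    · exact Or.inl h₂
    · exact Or.inr ⟨h₂, h₃⟩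
  · exact Or.inl (lt_of_le_of_ne h₁ fun h' => h (Fin.ext h'))

theorem PartsData.joinVertex_injective
    {d d' : PartsData {0}ᶜ S (SSet.stdSimplex.{u}.obj N) Δ[n] Δ[m]}
    (h : ∀ i, d.joinVertex i = d'.joinVertex i) : d = d' := by
  obtain ⟨χ, l, ρ⟩ := d
  obtain ⟨χ', l', ρ'⟩ := d'
  obtain rfl : χ = χ' := SSet.yonedaEquiv.injective (vertexOf_ext (n := ⦋r⦌) fun i =>
    Fin.ext (congrArg JoinVertex.base (h i)))
  obtain rfl : l = l' := part_hom_ext fun i _ => congrArg JoinVertex.left (h i)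
  obtain rfl : ρ = ρ' := part_hom_ext fun i _ => congrArg JoinVertex.right (h i)
  rfl

theorem PartsData.isFace :
    JoinVertex.IsFace r n m (IsValIn S) (Finset.univ.image d.joinVertex) := by
  have hle {i j} (h : d.joinVertex i ≤ d.joinVertex j) :
      i ≤ j ∨ d.joinVertex i = d.joinVertex j :=
    (le_total i j).imp_right fun h' => le_antisymm h (d.joinVertex_mono h')
  constructor
  all_goals simp only [Finset.mem_image, Finset.mem_univ, true_and, forall_exists_index,
    forall_apply_eq_imp_iff]
  · exact fun i => Fin.is_le _
  · exact fun i => partVertex_le _ _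
  · exact fun i => partVertex_le _ _
  · intro i hi
    refine partVertex_of_notMem d.left fun h => ?_
    exact mem_zero_compl_iff.1 h hi
  · intro i hi
    exact partVertex_of_notMem d.right fun h => hi (isValIn_val.2 h)
  · intro i j h
    rcases hle h with h | h
    · exact d.left_mono h
    · rw [h]
  · intro i j h hi hj
    rcases hle h with h | h
    · exact partVertex_mono _ h (isValIn_val.1 hi) (isValIn_val.1 hj)
    · rw [h]

theorem exists_partsData {N : ℕ} (F : Finset JoinVertex) (h : F.card = N + 1)
    (hF : JoinVertex.IsFace r n m (IsValIn S) F) :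
    ∃ d : PartsData {0}ᶜ S (SSet.stdSimplex.{u}.obj ⦋N⦌) Δ[n] Δ[m],
      ∀ i, d.joinVertex i = F.orderEmbOfFin h i := by
  let e := F.orderEmbOfFin h
  have he (i) : e i ∈ F := Finset.orderEmbOfFin_mem F h i
  have base_mono (i j) (hij : i ≤ j) : (e i).base ≤ (e j).base := by
    have := e.monotone hij
    rw [JoinVertex.le_iff] at this
    omega
  let χ : SSet.stdSimplex.{u}.obj ⦋N⦌ ⟶ Δ[r] := SSet.stdSimplex.map (SimplexCategory.mkHom
    { toFun := fun i => ⟨(e i).base, Nat.lt_succ_of_le (hF.base_le _ (he i))⟩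
      monotone' := fun i j hij => base_mono i j hij })
  obtain ⟨l, hl⟩ := exists_part_hom (χ := χ) (U := {0}ᶜ) (n := n) (fun i => (e i).left)
    (fun i _ => hF.left_le _ (he i)) (fun i j hij _ _ =>
      hF.left_mono _ (he i) _ (he j) (e.monotone hij))
  obtain ⟨ρ, hρ⟩ := exists_part_hom (χ := χ) (U := S) (n := m) (fun i => (e i).right)
    (fun i _ => hF.right_le _ (he i)) (fun i j hij hi hj =>
      hF.right_mono _ (he i) _ (he j) (e.monotone hij) (isValIn_val.2 hi) (isValIn_val.2 hj))
  refine ⟨⟨χ, l, ρ⟩, fun i => JoinVertex.ext rfl ?_ ?_⟩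
  · by_cases hi : vertexOf (SSet.yonedaEquiv χ) i ∈ ({0}ᶜ : Finset (Fin (r + 1)))
    · exact hl i hi
    · refine (partVertex_of_notMem l hi).trans (hF.left_eq _ (he i) ?_).symm
      rw [mem_zero_compl_iff, not_not] at hi
      exact hi
  · by_cases hi : vertexOf (SSet.yonedaEquiv χ) i ∈ S
    · exact hρ i hi
    · exact (partVertex_of_notMem ρ hi).trans
        (hF.right_eq _ (he i) fun h' => hi (isValIn_val.1 h')).symm

variable (S n m) in
/-- The simplices of a generalized join of standard simplices in terms of their vertices. -/
def joinVertexModel : VertexModel.{u} (partsJoin {0}ᶜ S Δ[n] Δ[m]) JoinVertex where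
  vert d := ⟨PartsData.joinVertex (N := ⦋_⦌) d, PartsData.joinVertex_mono (N := ⦋_⦌) d⟩
  vert_map f d i := by
    refine JoinVertex.ext ?_ ?_ ?_
    · exact congrArg Fin.val
        (vertexOf_yonedaEquiv_comp f (PartsData.χ (X := SSet.stdSimplex.obj ⦋_⦌) d) i)
    · exact partVertex_precomp f _ i
    · exact partVertex_precomp f _ i
  vert_injective h := PartsData.joinVertex_injective (N := ⦋_⦌) h
  IsFace := JoinVertex.IsFace r n m (IsValIn S)
  isFace_image_vert d := PartsData.isFace (N := ⦋_⦌) d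
  exists_simplex F h hF := exists_partsData F h hF

variable (S) in
/-- The simplices that miss the part over `0`, or all the parts over `2, …, r`, or whose second
component is in `B`. -/
def outerFamily {M : SSet.{u}} (B : M.Subcomplex) :
    StableFamily ({0}ᶜ : Finset (Fin (r + 1))) S M where
  obj L :=
    { obj k := Set.ofPred fun (t : PartsData {0}ᶜ S (SSet.stdSimplex.obj k.unop) L M) =>
        (∀ i, (t.vertex i).val ≠ 0) ∨ (∀ i, (t.vertex i).val < 2) ∨
          ∀ k x, t.right.app k x ∈ B.obj k
      map {k k'} f t ht := by
        have hv (i) := vertexOf_yonedaEquiv_comp f.unop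
          (PartsData.χ (X := SSet.stdSimplex.obj k.unop) t) i
        rcases ht with ht | ht | ht
        · refine Or.inl fun i => ?_
          exact ne_of_eq_of_ne (congrArg Fin.val (hv i)) (ht _)
        · refine Or.inr (Or.inl fun i => ?_)
          exact lt_of_eq_of_lt (congrArg Fin.val (hv i)) (ht _)
        · exact Or.inr (Or.inr fun _ _ => ht _ _) }
  mem_iff _ _ _ := Iff.rfl
  mem_of_forall_notMem t ht := Or.inr (Or.inl fun i => by
    have h := ht i
    rw [mem_zero_compl_iff, not_not] at h
    exact h.trans_lt Nat.zero_lt_two)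

theorem mem_range_mapLeft_iff {r : ℕ} {S T : Finset (Fin (r + 1))} {A M : SSet.{u}}
    (B : A.Subcomplex) {k : SimplexCategoryᵒᵖ}
    (t : PartsData S T (SSet.stdSimplex.obj k.unop) A M) :
    (show (partsJoin S T A M).obj k from t) ∈ (SSet.Subcomplex.range (mapLeft B.ι M)).obj k ↔
      ∀ k x, t.left.app k x ∈ B.obj k := by
  constructor
  · rintro ⟨t, rfl⟩ k x
    exact (t.left.app k x).2
  · intro h
    refine ⟨(⟨t.χ, Subfunctor.lift t.left ?_, t.right⟩ :
      PartsData S T (SSet.stdSimplex.obj k.unop) B M), rfl⟩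
    rintro k _ ⟨x, rfl⟩
    exact h k x

variable (S n m) in
/-- The simplices of the generalized join of `Δ[n]` and `Δ[m]` that lie in `outerFamily` for the
boundary of `Δ[m]`, or whose first component is in the boundary of `Δ[n]`. -/
abbrev outerSubcomplex : (partsJoin {0}ᶜ S Δ[n] Δ[m] : SSet.{u}).Subcomplex :=
  (outerFamily S (SSet.boundary m)).obj Δ[n] ⊔
    SSet.Subcomplex.range (mapLeft (SSet.boundary n).ι Δ[m])

theorem mem_outerSubcomplex_iff {N : ℕ}
    (d : PartsData {0}ᶜ S (SSet.stdSimplex.{u}.obj ⦋N⦌) Δ[n] Δ[m]) :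
    (show (partsJoin {0}ᶜ S Δ[n] Δ[m] : SSet.{u}) _⦋N⦌ from d) ∈ (outerSubcomplex S n m).obj _ ↔
      ((∀ i, (d.vertex i).val ≠ 0) ∨ (∀ i, (d.vertex i).val < 2) ∨
        ∃ w ≤ m, ∀ i, d.vertex i ∈ S → partVertex d.right i ≠ w) ∨
      ∃ k ≤ n, ∀ i, d.vertex i ∈ ({0}ᶜ : Finset (Fin (r + 1))) → partVertex d.left i ≠ k := by
  refine or_congr (or_congr Iff.rfl (or_congr Iff.rfl ?_))
    ((mem_range_mapLeft_iff _ _).trans ?_)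
  · exact forall_mem_boundary_iff (N := ⦋N⦌) d.right
  · exact forall_mem_boundary_iff (N := ⦋N⦌) d.left

theorem notMem_outerSubcomplex_iff {N : ℕ}
    (d : PartsData {0}ᶜ S (SSet.stdSimplex.{u}.obj ⦋N⦌) Δ[n] Δ[m]) :
    (show (partsJoin {0}ᶜ S Δ[n] Δ[m] : SSet.{u}) _⦋N⦌ from d) ∉ (outerSubcomplex S n m).obj _ ↔
      JoinVertex.IsFull n m (IsValIn S) (Finset.univ.image d.joinVertex) := by
  have isFull_iff : JoinVertex.IsFull n m (IsValIn S) (Finset.univ.image d.joinVertex) ↔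
      (∃ i, (d.vertex i).val = 0) ∧ (∃ i, 2 ≤ (d.vertex i).val) ∧
        (∀ k ≤ n, ∃ i, (d.vertex i).val ≠ 0 ∧ partVertex d.left i = k) ∧
        ∀ w ≤ m, ∃ i, IsValIn S (d.vertex i).val ∧ partVertex d.right i = w := by
    have exists_iff (P : JoinVertex → Prop) :
        (∃ x ∈ Finset.univ.image d.joinVertex, P x) ↔ ∃ i, P (d.joinVertex i) := by
      simp only [Finset.mem_image, Finset.mem_univ, true_and, exists_exists_eq_and]
    refine ⟨fun h => ⟨(exists_iff _).1 h.zero, (exists_iff _).1 h.two,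
      fun k hk => (exists_iff _).1 (h.left_surj k hk),
      fun w hw => (exists_iff _).1 (h.right_surj w hw)⟩, fun ⟨h₀, h₂, hn, hm⟩ => ?_⟩
    exact ⟨(exists_iff _).2 h₀, (exists_iff _).2 h₂, fun k hk => (exists_iff _).2 (hn k hk),
      fun w hw => (exists_iff _).2 (hm w hw)⟩
  rw [isFull_iff, mem_outerSubcomplex_iff]
  push Not
  simp only [isValIn_val, mem_zero_compl_iff]
  tauto

/-- The corner of `JoinVertex.corner` pairs the simplices outside `outerSubcomplex`. -/
def outerCornerData (h0 : 0 ∈ S) :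
    (joinVertexModel.{u} S n m).CornerData (outerSubcomplex S n m) where
  Outside := JoinVertex.IsFull n m (IsValIn S)
  notMem_iff d := notMem_outerSubcomplex_iff d
  corner := JoinVertex.corner (IsValIn S)
  outside_insert _ hf := hf.mono (Finset.subset_insert _ _)
  isFace_insert hg hf := hg.insert_corner (isValIn_val.2 h0) hf
  corner_insert _ _ := JoinVertex.corner_insert_corner
  outside_erase _ hf := hf.erase_corner (isValIn_val.2 h0)
  corner_erase _ _ := JoinVertex.corner_erase rfl le_rfl
  exists_lt _ hf := hf.zero.imp fun _ h =>
    ⟨h.1, JoinVertex.lt_of_base_lt (h.2.trans_lt Nat.zero_lt_one)⟩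
  exists_gt _ hf := hf.two.imp fun _ h => ⟨h.1, JoinVertex.lt_of_base_lt h.2⟩
  weight := JoinVertex.weight n
  weight_lt hg hf hu hz hne h := JoinVertex.weight_lt hg hf hu hz hne h

theorem extends_outerFamily (h0 : 0 ∈ S) {C : SSet.{u}} [SSet.Quasicategory C] (K : SSet.{u}) :
    Extends C ((outerFamily S (SSet.boundary m)).obj K) := by
  refine StableFamily.extends_of_cells fun n f => ?_
  have isInnerAnodyne := (outerCornerData.{u} (n := n) (m := m) h0).innerAnodyneExtensions
  have isInnerFibration : SSet.innerFibrations (terminal.from C) :=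
    ((SSet.quasicategory_iff_innerFibration C).1 inferInstance).mem
  have sq : CommSq f (outerSubcomplex S n m).ι (terminal.from C) (terminal.from _) :=
    ⟨terminal.hom_ext _ _⟩
  have := isInnerAnodyne _ isInnerFibration
  exact ⟨sq.lift, sq.fac_left⟩

end

/-! ### Shapes and generalized slices -/

/-- The shape of a generalized slice: the dimension of the simplex `Δ[dim]` over which the
generalized joins live, and the set of vertices over which the varying variable of the join is
placed. The fixed variable is always placed over the vertices other than `0`. -/
structure Shape where
  dim : ℕ
  carrier : Finset (Fin (dim + 1))
  zero_mem : 0 ∈ carrier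

namespace Shape

/-- A morphism of shapes: a map of simplices along which generalized joins can be pushed forward,
see `Shape.Hom.mapJoin`. -/
@[ext]
structure Hom (D E : Shape) where
  hom : ⦋D.dim⦌ ⟶ ⦋E.dim⦌
  mem_carrier : ∀ i, hom.toOrderHom i ∈ E.carrier → i ∈ D.carrier
  mem_zero_compl : ∀ i, hom.toOrderHom i ∈ ({0}ᶜ : Finset (Fin (E.dim + 1))) ↔
    i ∈ ({0}ᶜ : Finset (Fin (D.dim + 1)))

instance : Category Shape where
  Hom := Hom
  id D := ⟨𝟙 _, fun _ h => h, fun _ => Iff.rfl⟩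
  comp d e := ⟨d.hom ≫ e.hom, fun _ h => d.mem_carrier _ (e.mem_carrier _ h),
    fun _ => (e.mem_zero_compl _).trans (d.mem_zero_compl _)⟩

@[ext]
theorem hom_ext {D E : Shape} {d e : D ⟶ E} (h : Hom.hom d = Hom.hom e) : d = e := Hom.ext h

variable (D : Shape) {V K C : SSet.{u}}

/-- The generalized join of shape `D`. -/
abbrev join (V K : SSet.{u}) : SSet.{u} := partsJoin D.carrier {0}ᶜ V K

/-- The simplices of the generalized joins with `K` that miss the part over `0`. -/
def awayFamily (K : SSet.{u}) :
    StableFamily D.carrier ({0}ᶜ : Finset (Fin (D.dim + 1))) K where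
  obj L :=
    { obj k := Set.ofPred
        fun (t : PartsData D.carrier {0}ᶜ (SSet.stdSimplex.obj k.unop) L K) =>
          ∀ i, t.vertex i ∈ ({0}ᶜ : Finset (Fin (D.dim + 1)))
      map {k k'} f t ht i := by
        have h := vertexOf_yonedaEquiv_comp f.unop
          (PartsData.χ (X := SSet.stdSimplex.obj k.unop) t) i
        exact (congrArg (· ∈ ({0}ᶜ : Finset (Fin (D.dim + 1)))) h).mpr (ht _) }
  mem_iff _ _ _ := Iff.rfl
  mem_of_forall_notMem t ht i := by
    rw [Finset.mem_compl, Finset.mem_singleton]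
    exact fun h => ht i ((congrArg (· ∈ D.carrier) h).mpr D.zero_mem)

/-- The projection to `K` of the simplices of a generalized join that miss the part over `0`. -/
def awayProj (K L : SSet.{u}) : ((D.awayFamily K).obj L : SSet.{u}) ⟶ K where
  app k := ↾fun t => (PartsData.right (X := SSet.stdSimplex.obj k.unop) t.1).app k
    ⟨SSet.yonedaEquiv (𝟙 (SSet.stdSimplex.obj k.unop)), (mem_part_iff _ _ _).2 fun i => t.2 i⟩
  naturality k k' f := by
    refine ConcreteCategory.hom_ext _ _ fun t => ?_
    refine Eq.trans ?_ (NatTrans.naturality_apply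
      (PartsData.right (X := SSet.stdSimplex.obj k.unop) t.1) f
      ⟨SSet.yonedaEquiv (𝟙 (SSet.stdSimplex.obj k.unop)), (mem_part_iff _ _ _).2 fun i => t.2 i⟩)
    refine congrArg ((PartsData.right (X := SSet.stdSimplex.obj k.unop) t.1).app k') ?_
    exact Subtype.ext (SSet.yonedaEquiv_naturality f.unop
      (𝟙 (SSet.stdSimplex.obj k.unop))).symm

variable (p : K ⟶ C)

/-- The generalized slice of shape `D`: its `n`-simplices are the maps from the generalized join of
`Δ[n]` and `K` to `C` that restrict to `p` away from the part over `0`. -/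
def slice : SSet.{u} := (D.awayFamily K).relMaps (D.awayProj K Δ[0] ≫ p)

/-- The condition for a map from a generalized join to restrict to `p` away from the part over
`0`. -/
def RestrictsTo (H : D.join V K ⟶ C) : Prop :=
  ((D.awayFamily K).obj V).ι ≫ H = D.awayProj K V ≫ p

variable {D p}

theorem RestrictsTo.apply {H : D.join V K ⟶ C} (hH : D.RestrictsTo p H)
    {k} (t : (D.join V K).obj k) (ht : t ∈ ((D.awayFamily K).obj V).obj k) :
    H.app k t = p.app k ((D.awayProj K V).app k ⟨t, ht⟩) :=
  ConcreteCategory.congr_hom (NatTrans.congr_app hH k) ⟨t, ht⟩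

theorem RestrictsTo.mapLeft {V' : SSet.{u}} (g : V' ⟶ V) {H : D.join V K ⟶ C}
    (hH : D.RestrictsTo p H) : D.RestrictsTo p (mapLeft g K ≫ H) :=
  congrArg (fun z => (D.awayFamily K).map g ≫ z) hH

theorem RestrictsTo.hom_ext {H H' : D.join V K ⟶ C}
    (hH : D.RestrictsTo p H) (hH' : D.RestrictsTo p H')
    (h : ∀ {n : SimplexCategory} (x : SSet.stdSimplex.obj n ⟶ V),
      InftySlice.mapLeft x K ≫ H = InftySlice.mapLeft x K ≫ H') : H = H' :=
  StableFamily.assembly_unique (F := D.awayFamily K) h (hH.trans hH'.symm)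

theorem exists_uncurry (ρ : V ⟶ D.slice p) :
    ∃ H : D.join V K ⟶ C, D.RestrictsTo p H ∧
      ∀ {n : SimplexCategory} (x : SSet.stdSimplex.obj n ⟶ V),
        mapLeft x K ≫ H = StableFamily.evalHom (F := D.awayFamily K)
          (f := D.awayProj K Δ[0] ≫ p) (x ≫ ρ) := by
  obtain ⟨H, h, h'⟩ := StableFamily.exists_assembly (F := D.awayFamily K)
    (f := D.awayProj K Δ[0] ≫ p) ρ
  exact ⟨H, h', h⟩

/-- The map from a generalized join corresponding to a map to a generalized slice. -/
def uncurry (ρ : V ⟶ D.slice p) : D.join V K ⟶ C := (exists_uncurry ρ).choose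

theorem restrictsTo_uncurry (ρ : V ⟶ D.slice p) : D.RestrictsTo p (uncurry ρ) :=
  (exists_uncurry ρ).choose_spec.1

theorem mapLeft_uncurry (ρ : V ⟶ D.slice p) {n : SimplexCategory}
    (x : SSet.stdSimplex.obj n ⟶ V) :
    mapLeft x K ≫ uncurry ρ = StableFamily.evalHom (F := D.awayFamily K)
      (f := D.awayProj K Δ[0] ≫ p) (x ≫ ρ) := (exists_uncurry ρ).choose_spec.2 x

theorem uncurry_injective {ρ ρ' : V ⟶ D.slice p} (h : uncurry ρ = uncurry ρ') : ρ = ρ' :=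
  StableFamily.relMaps_hom_ext (SSet.stdSimplex.isTerminalObj₀.hom_ext _ _) fun x => by
    rw [← mapLeft_uncurry, ← mapLeft_uncurry, h]

theorem uncurry_comp {V' : SSet.{u}} (g : V' ⟶ V) (ρ : V ⟶ D.slice p) :
    uncurry (g ≫ ρ) = mapLeft g K ≫ uncurry ρ :=
  (restrictsTo_uncurry _).hom_ext ((restrictsTo_uncurry _).mapLeft g) fun x =>
    (mapLeft_uncurry (g ≫ ρ) x).trans (mapLeft_uncurry ρ (x ≫ g)).symm

theorem exists_uncurry_eq {H : D.join V K ⟶ C} (hH : D.RestrictsTo p H) :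
    ∃ ρ : V ⟶ D.slice p, uncurry ρ = H := by
  obtain ⟨ρ, -, h⟩ := StableFamily.exists_hom_relMaps (F := D.awayFamily K)
    (f := D.awayProj K Δ[0] ≫ p) (SSet.stdSimplex.isTerminalObj₀.from V) H hH
  exact ⟨ρ, (restrictsTo_uncurry _).hom_ext hH fun x => (mapLeft_uncurry ρ x).trans (h x)⟩

/-- The map to a generalized slice corresponding to a map from a generalized join. -/
def curry {H : D.join V K ⟶ C} (hH : D.RestrictsTo p H) : V ⟶ D.slice p :=
  (exists_uncurry_eq hH).choose

theorem uncurry_curry {H : D.join V K ⟶ C} (hH : D.RestrictsTo p H) : uncurry (curry hH) = H :=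
  (exists_uncurry_eq hH).choose_spec

namespace Hom

variable {D E F : Shape}

/-- The functoriality of the generalized join in the shape. -/
def mapJoin (d : D ⟶ E) (V K : SSet.{u}) : D.join V K ⟶ E.join V K :=
  reindex d.hom d.mem_carrier (fun i => (d.mem_zero_compl i).1) V K

theorem mapJoin_app_mem_awayFamily_iff (d : D ⟶ E) {k : SimplexCategoryᵒᵖ}
    (t : (D.join V K).obj k) :
    (mapJoin d V K).app k t ∈ ((E.awayFamily K).obj V).obj k ↔
      t ∈ ((D.awayFamily K).obj V).obj k :=
  forall_congr' fun _ => d.mem_zero_compl _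

theorem restrictsTo_mapJoin (d : D ⟶ E) {H : E.join V K ⟶ C} (hH : E.RestrictsTo p H) :
    D.RestrictsTo p (mapJoin d V K ≫ H) := by
  refine NatTrans.ext (funext fun k => ConcreteCategory.hom_ext _ _ fun t => ?_)
  exact hH.apply _ ((mapJoin_app_mem_awayFamily_iff d t.1).2 t.2)

theorem mapJoin_id (V K : SSet.{u}) : mapJoin (𝟙 D) V K = 𝟙 _ := by
  refine NatTrans.ext (funext fun k => ConcreteCategory.hom_ext _ _ fun t => ?_)
  refine PartsData.ext_of_apply (X := SSet.stdSimplex.obj k.unop) ?_ (fun _ _ _ _ => rfl)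
    (fun _ _ _ _ => rfl)
  have h : (SSet.stdSimplex.map (𝟙 ⦋D.dim⦌) : Δ[D.dim] ⟶ Δ[D.dim]) = 𝟙 _ :=
    SSet.stdSimplex.map_id _
  exact (congrArg (PartsData.χ (X := SSet.stdSimplex.obj k.unop) t ≫ ·) h).trans
    (Category.comp_id _)

variable (p) in
/-- The functoriality of the generalized slice in the shape. -/
def res (d : D ⟶ E) : E.slice p ⟶ D.slice p :=
  curry (restrictsTo_mapJoin d (restrictsTo_uncurry (𝟙 (E.slice p))))

theorem uncurry_comp_res (d : D ⟶ E) (ρ : V ⟶ E.slice p) :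
    uncurry (ρ ≫ res p d) = mapJoin d V K ≫ uncurry ρ := by
  have h := uncurry_comp ρ (𝟙 (E.slice p))
  rw [Category.comp_id] at h
  rw [uncurry_comp, res, uncurry_curry, h]
  rfl

theorem uncurry_res (d : D ⟶ E) :
    uncurry (res p d) = mapJoin d _ K ≫ uncurry (𝟙 (E.slice p)) :=
  uncurry_curry _

variable (p) in
theorem res_id : res p (𝟙 D) = 𝟙 _ :=
  uncurry_injective (by rw [uncurry_res, mapJoin_id, Category.id_comp])

variable (p) in
theorem res_comp (d : D ⟶ E) (e : E ⟶ F) : res p (d ≫ e) = res p e ≫ res p d :=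
  uncurry_injective (by rw [uncurry_comp_res, uncurry_res, uncurry_res]; rfl)

theorem mapJoin_app_injective (d : D ⟶ E) [IsSplitMono d.hom]
    (hd : ∀ i ∈ D.carrier, d.hom.toOrderHom i ∈ E.carrier) {k} {t t' : (D.join V K).obj k}
    (h : (mapJoin d V K).app k t = (mapJoin d V K).app k t') : t = t' := by
  obtain ⟨χ, l, ρ⟩ := t
  obtain ⟨χ', l', ρ'⟩ := t'
  have hχ : χ ≫ SSet.stdSimplex.map d.hom = χ' ≫ SSet.stdSimplex.map d.hom :=
    congrArg PartsData.χ h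
  have : Mono (SSet.stdSimplex.{u}.map d.hom) :=
    ((IsSplitMono.exists_splitMono (f := d.hom)).some.map SSet.stdSimplex).mono
  obtain rfl : χ = χ' := (cancel_mono _).1 hχ
  have hl := eq_of_heq (PartsData.mk.inj h).2.1
  have hρ := eq_of_heq (PartsData.mk.inj h).2.2
  refine PartsData.ext_of_apply rfl (fun n x hx _ => ?_) fun n x hx _ => ?_
  · have hx' : x ∈ (part (χ ≫ SSet.stdSimplex.map d.hom) E.carrier).obj n :=
      (mem_part_iff _ _ _).2 fun i => hd _ ((mem_part_iff _ _ _).1 hx i)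
    exact ConcreteCategory.congr_hom (NatTrans.congr_app hl n) ⟨x, hx'⟩
  · have hx' : x ∈ (part (χ ≫ SSet.stdSimplex.map d.hom) {0}ᶜ).obj n :=
      (mem_part_iff _ _ _).2 fun i => (d.mem_zero_compl _).2 ((mem_part_iff _ _ _).1 hx i)
    exact ConcreteCategory.congr_hom (NatTrans.congr_app hρ n) ⟨x, hx'⟩

theorem exists_mapJoin_app_eq (d : D ⟶ E) (s : ⦋E.dim⦌ ⟶ ⦋D.dim⦌)
    (hd : ∀ i ∈ D.carrier, d.hom.toOrderHom i ∈ E.carrier) {k : SimplexCategoryᵒᵖ}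
    (t : PartsData E.carrier {0}ᶜ (SSet.stdSimplex.obj k.unop) V K)
    (ht : ∀ i, d.hom.toOrderHom (s.toOrderHom (t.vertex i)) = t.vertex i) :
    ∃ τ : (D.join V K).obj k, (mapJoin d V K).app k τ = t := by
  have hle {U : Finset (Fin (D.dim + 1))} {U' : Finset (Fin (E.dim + 1))}
      (hU : ∀ i, i ∈ U → d.hom.toOrderHom i ∈ U') :
      part (t.χ ≫ SSet.stdSimplex.map s) U ≤ part t.χ U' := by
    intro n x hx
    refine (mem_part_iff _ _ _).2 fun i => ?_
    have := hU _ ((mem_part_iff _ _ _).1 hx i)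
    exact (congrArg (· ∈ U') (ht _)).mp this
  refine ⟨(⟨t.χ ≫ SSet.stdSimplex.map s, SSet.Subcomplex.homOfLE (hle hd) ≫ t.left,
    SSet.Subcomplex.homOfLE (hle fun i => (d.mem_zero_compl i).2) ≫ t.right⟩ :
      PartsData D.carrier {0}ᶜ (SSet.stdSimplex.obj k.unop) V K), ?_⟩
  refine PartsData.ext_of_apply ?_ (fun _ _ _ _ => rfl) (fun _ _ _ _ => rfl)
  exact SSet.yonedaEquiv.injective (vertexOf_ext (n := ⦋E.dim⦌) fun i => ht i)

end Hom

end Shape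

theorem Extends.preimage {X Y C : SSet.{u}} {A : Y.Subcomplex} (hA : Extends C A) (e : X ≅ Y) :
    Extends C (A.preimage e.hom) := by
  intro f
  have hom_inv {k} (y : Y.obj k) : e.hom.app k (e.inv.app k y) = y :=
    ConcreteCategory.congr_hom (NatTrans.congr_app e.inv_hom_id k) y
  have inv_hom {k} (x : X.obj k) : e.inv.app k (e.hom.app k x) = x :=
    ConcreteCategory.congr_hom (NatTrans.congr_app e.hom_inv_id k) x
  obtain ⟨g, hg⟩ := hA (Subfunctor.lift (A.ι ≫ e.inv) (G := A.preimage e.hom) (by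
    rintro k _ ⟨y, rfl⟩
    exact (congrArg (· ∈ A.obj k) (hom_inv y.1)).mpr y.2) ≫ f)
  refine ⟨e.hom ≫ g, ?_⟩
  refine NatTrans.ext (funext fun k => ConcreteCategory.hom_ext _ _ fun x => ?_)
  refine (ConcreteCategory.congr_hom (NatTrans.congr_app hg k) ⟨e.hom.app k x.1, x.2⟩).trans ?_
  exact congrArg (f.app k) (Subtype.ext (inv_hom x.1))

/-- The map `⦋r⦌ ⟶ ⦋1⦌` that sends only `0` to `0`. -/
def collapse (r : ℕ) : ⦋r⦌ ⟶ ⦋1⦌ :=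
  SimplexCategory.mkHom
    { toFun := fun i => if i = 0 then 0 else 1
      monotone' := fun i j hij => by
        dsimp only
        split_ifs with hi hj
        · rfl
        · exact Fin.zero_le _
        · exact absurd (Fin.le_zero_iff.1 (‹j = 0› ▸ hij)) hi
        · rfl }

theorem apply_collapse {r : ℕ} {d : ⦋1⦌ ⟶ ⦋r⦌} (hd : ∀ i, (d.toOrderHom i).val = i.val)
    {i : Fin (r + 1)} (hi : i.val < 2) : d.toOrderHom ((collapse r).toOrderHom i) = i := by
  refine Fin.ext ((hd _).trans ?_)
  change (if i = 0 then (0 : Fin 2) else 1).val = i.val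
  split_ifs with h
  · exact (congrArg Fin.val h).symm
  · have : i.val ≠ 0 := fun h' => h (Fin.ext h')
    change 1 = i.val
    lia

theorem isSplitMono_of_val_eq {r : ℕ} {d : ⦋1⦌ ⟶ ⦋r⦌}
    (hd : ∀ i, (d.toOrderHom i).val = i.val) : IsSplitMono d := by
  have injective : Function.Injective d.toOrderHom := fun i j h =>
    Fin.ext ((hd i).symm.trans ((congrArg Fin.val h).trans (hd j)))
  refine IsSplitMono.mk' ⟨collapse r, SimplexCategory.Hom.ext _ _ (OrderHom.ext _ _ ?_)⟩
  exact funext fun i => injective (apply_collapse hd ((hd i).trans_lt i.isLt))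

namespace Shape.Hom

section

variable {D E : Shape} {A K C : SSet.{u}} {p : K ⟶ C} (d : D ⟶ E)
  (hS : ∀ i ∈ D.carrier, d.hom.toOrderHom i ∈ E.carrier)
  {B : A.Subcomplex} {H : E.join (B : SSet.{u}) K ⟶ C} {h : D.join A K ⟶ C}
  (hHh : mapJoin d _ K ≫ H = mapLeft B.ι K ≫ h)

include hS hHh in
theorem app_eq_of_mapJoin_app_eq {k} {τ : (D.join A K).obj k}
    {τ' : (E.join (B : SSet.{u}) K).obj k}
    (e : (mapJoin d A K).app k τ = (mapLeft B.ι K).app k τ') : h.app k τ = H.app k τ' := by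
  obtain ⟨σ, rfl⟩ : τ ∈ (SSet.Subcomplex.range (mapLeft B.ι K)).obj k := by
    have left_mem := (mem_range_mapLeft_iff B ((mapJoin d A K).app k τ)).1 ⟨τ', e.symm⟩
    exact (mem_range_mapLeft_iff B τ).2 fun k' x =>
      left_mem k' ⟨x.1, (mem_part_iff _ _ _).2 fun i => hS _ ((mem_part_iff _ _ _).1 x.2 i)⟩
  have e' : (mapLeft B.ι K).app k ((mapJoin d _ K).app k σ) = (mapLeft B.ι K).app k τ' := e
  rw [← StableFamily.mapLeft_app_injective _ e']
  exact (ConcreteCategory.congr_hom (NatTrans.congr_app hHh k) σ).symm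

theorem awayProj_comp_app_eq_of_mapLeft (hH : E.RestrictsTo p H) {k}
    {t : ((E.awayFamily K).obj A : SSet.{u}).obj k} {τ : (E.join (B : SSet.{u}) K).obj k}
    (e : t.1 = (mapLeft B.ι K).app k τ) : (E.awayProj K A ≫ p).app k t = H.app k τ := by
  obtain ⟨_, ht⟩ := t
  subst e
  exact (hH.apply τ ht).symm

theorem awayProj_comp_app_eq_of_mapJoin (hh : D.RestrictsTo p h) {k}
    {t : ((E.awayFamily K).obj A : SSet.{u}).obj k} {τ : (D.join A K).obj k}
    (e : t.1 = (mapJoin d A K).app k τ) : (E.awayProj K A ≫ p).app k t = h.app k τ := by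
  obtain ⟨_, ht⟩ := t
  subst e
  exact (hh.apply τ ((mapJoin_app_mem_awayFamily_iff d τ).1 ht)).symm

include hS hHh in
theorem exists_common_extension [IsSplitMono d.hom]
    (hC : Extends C ((E.awayFamily K).obj A ⊔ (SSet.Subcomplex.range (mapJoin d A K) ⊔
      SSet.Subcomplex.range (mapLeft B.ι K))))
    (hH : E.RestrictsTo p H) (hh : D.RestrictsTo p h) :
    ∃ g : E.join A K ⟶ C, E.RestrictsTo p g ∧ mapJoin d A K ≫ g = h ∧ mapLeft B.ι K ≫ g = H := by
  let Piece : Option Bool → SSet.{u} := fun b => match b with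
    | none => (E.awayFamily K).obj A
    | some true => D.join A K
    | some false => E.join B K
  let inclusion : ∀ b, Piece b ⟶ E.join A K := fun b => match b with
    | none => ((E.awayFamily K).obj A).ι
    | some true => mapJoin d A K
    | some false => mapLeft B.ι K
  let value : ∀ b, Piece b ⟶ C := fun b => match b with
    | none => E.awayProj K A ≫ p
    | some true => h
    | some false => H
  have union : (⨆ b, SSet.Subcomplex.range (inclusion b)) = (E.awayFamily K).obj A ⊔
      (SSet.Subcomplex.range (mapJoin d A K) ⊔ SSet.Subcomplex.range (mapLeft B.ι K)) := by
    rw [iSup_option, iSup_bool_eq]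
    exact congrArg (· ⊔ _) (Subfunctor.range_ι ((E.awayFamily K).obj A))
  obtain ⟨g, hg⟩ : ∃ g : E.join A K ⟶ C, ∀ b, inclusion b ≫ g = value b := by
    refine Extends.exists_of_compatible (union ▸ hC) value ?_
    rintro (_ | _ | _) (_ | _ | _) k t t' e
    · exact congrArg ((E.awayProj K A ≫ p).app k) (Subtype.ext e)
    · exact awayProj_comp_app_eq_of_mapLeft hH e
    · exact awayProj_comp_app_eq_of_mapJoin d hh e
    · exact (awayProj_comp_app_eq_of_mapLeft hH e.symm).symm
    · exact congrArg (H.app k) (StableFamily.mapLeft_app_injective _ e)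
    · exact (app_eq_of_mapJoin_app_eq d hS hHh e.symm).symm
    · exact (awayProj_comp_app_eq_of_mapJoin d hh e.symm).symm
    · exact app_eq_of_mapJoin_app_eq d hS hHh e
    · exact congrArg (h.app k) (mapJoin_app_injective d hS e)
  exact ⟨g, hg none, hg (some true), hg (some false)⟩

end

section

variable {S : Finset (Fin 2)} {h0 : 0 ∈ S} {E : Shape} (d : (⟨1, S, h0⟩ : Shape) ⟶ E)
  (hd : ∀ i, (d.hom.toOrderHom i).val = i.val)
  (hS : ∀ i ∈ S, d.hom.toOrderHom i ∈ E.carrier)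

include hd hS in
theorem sup_range_eq_preimage_outerFamily {A : SSet.{u}} (B : A.Subcomplex) (K : SSet.{u}) :
    (E.awayFamily K).obj A ⊔ (SSet.Subcomplex.range (mapJoin d A K) ⊔
      SSet.Subcomplex.range (mapLeft B.ι K)) =
    ((outerFamily E.carrier B).obj K).preimage (partsSwap E.carrier {0}ᶜ A K) := by
  apply le_antisymm
  · rintro k t (ht | ⟨τ, rfl⟩ | ht)
    · exact Or.inl fun i => mem_zero_compl_iff.1 (ht i)
    · exact Or.inr (Or.inl fun i =>
        (hd _).trans_lt (PartsData.vertex (n := k.unop) τ i).isLt)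
    · exact Or.inr (Or.inr ((mem_range_mapLeft_iff B t).1 ht))
  · rintro k t (ht | ht | ht)
    · exact Or.inl fun i => mem_zero_compl_iff.2 (ht i)
    · exact Or.inr (Or.inl (exists_mapJoin_app_eq d (collapse E.dim) hS t fun i =>
        apply_collapse hd (ht i)))
    · exact Or.inr (Or.inr ((mem_range_mapLeft_iff B t).2 ht))

include hd hS in
theorem res_mem_rlp_monomorphisms {K C : SSet.{u}} [SSet.Quasicategory C] (p : K ⟶ C) :
    (MorphismProperty.monomorphisms SSet.{u}).rlp (res p d) := by
  rw [SSet.rlp_monomorphisms]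
  rintro _ _ _ ⟨m⟩
  refine ⟨fun {ρ y} sq => ?_⟩
  have := isSplitMono_of_val_eq hd
  have extends_union : Extends C ((E.awayFamily K).obj Δ[m] ⊔
      (SSet.Subcomplex.range (mapJoin d Δ[m] K) ⊔
        SSet.Subcomplex.range (mapLeft (SSet.boundary m).ι K))) := by
    rw [sup_range_eq_preimage_outerFamily d hd hS]
    exact (extends_outerFamily E.zero_mem K).preimage
      ⟨partsSwap _ _ _ _, partsSwap _ _ _ _, rfl, rfl⟩
  obtain ⟨g, hg, hgy, hgρ⟩ := exists_common_extension d hS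
    (by rw [← uncurry_comp_res, sq.w, uncurry_comp]) extends_union
    (restrictsTo_uncurry ρ) (restrictsTo_uncurry y)
  refine ⟨⟨⟨curry hg, uncurry_injective ?_, uncurry_injective ?_⟩⟩⟩
  · rw [uncurry_comp, uncurry_curry, hgρ]
  · rw [uncurry_comp_res, uncurry_curry, hgy]

end

end Shape.Hom

/-! ### Isomorphisms of functors from trivial fibrations -/

section

variable {X Y Z : SSet.{u}}

theorem AreIsomorphic.of_map {X' Y' : SSet.{u}} (k : (ihom X).obj Y ⟶ (ihom X').obj Y')
    {f g : X ⟶ Y} {f' g' : X' ⟶ Y'} (hf : k.app _ (mapVertex f) = mapVertex f')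
    (hg : k.app _ (mapVertex g) = mapVertex g') (h : AreIsomorphic f g) :
    AreIsomorphic f' g' := by
  obtain ⟨e, ⟨I⟩⟩ := h
  exact ⟨(e.map k).ofEq hf hg, ⟨(I.map k).ofEq rfl⟩⟩

theorem AreIsomorphic.comp_right {f g : X ⟶ Y} (h : AreIsomorphic f g) (b : Y ⟶ Z) :
    AreIsomorphic (f ≫ b) (g ≫ b) := by
  have map_mapVertex (f : X ⟶ Y) :
      ((ihom X).map b).app _ (mapVertex f) = mapVertex (f ≫ b) := by
    rw [mapVertex, ← SSet.yonedaEquiv_comp, ← MonoidalClosed.curry_natural_right, Category.assoc]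
    rfl
  exact h.of_map _ (map_mapVertex f) (map_mapVertex g)

theorem AreIsomorphic.comp_left (a : X ⟶ Y) {f g : Y ⟶ Z} (h : AreIsomorphic f g) :
    AreIsomorphic (a ≫ f) (a ≫ g) := by
  have pre_mapVertex (f : Y ⟶ Z) :
      ((MonoidalClosed.pre a).app Z).app _ (mapVertex f) = mapVertex (a ≫ f) := by
    rw [mapVertex, ← SSet.yonedaEquiv_comp, MonoidalClosed.curry_pre_app, mapVertex,
      whiskerRight_fst_assoc]
  exact h.of_map _ (pre_mapVertex f) (pre_mapVertex g)

end

section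

variable {W Z B J : SSet.{u}}

/-- The inclusion of `W` in `W ⊗ J` at a vertex of `J`. -/
def atVertex (W : SSet.{u}) (x : J _⦋0⦌) : W ⟶ W ⊗ J := lift (𝟙 W) (SSet.const x)

theorem const_app_injective {n : SimplexCategoryᵒᵖ} (w w' : W.obj n) {x y : J _⦋0⦌}
    (h : (SSet.const x : W ⟶ J).app n w = (SSet.const y : W ⟶ J).app n w') : x = y := by
  have map_const (z : J _⦋0⦌) (v : W.obj n) :
      J.map (SimplexCategory.const ⦋0⦌ n.unop 0).op ((SSet.const z : W ⟶ J).app n v) = z := by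
    refine (NatTrans.naturality_apply (SSet.const z : W ⟶ J)
      (SimplexCategory.const ⦋0⦌ n.unop 0).op v).symm.trans ?_
    have : (SimplexCategory.const ⦋0⦌ ⦋0⦌ 0).op = 𝟙 _ :=
      congrArg Quiver.Hom.op (Subsingleton.elim _ _)
    exact (congrArg (fun k => J.map k z) this).trans (ConcreteCategory.congr_hom (J.map_id _) z)
  rw [← map_const x w, h, map_const]

theorem mono_desc_atVertex (W : SSet.{u}) {x y : J _⦋0⦌} (hxy : x ≠ y) :
    Mono (FunctorToTypes.coprod.desc (atVertex W x) (atVertex W y)) := by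
  refine (NatTrans.mono_iff_mono_app _).2 fun n => (mono_iff_injective _).2 ?_
  rintro (w | w) (w' | w') h
  · exact congrArg Sum.inl (congrArg Prod.fst h)
  · exact absurd (const_app_injective w w' (congrArg Prod.snd h)) hxy
  · exact absurd (const_app_injective w w' (congrArg Prod.snd h)) hxy.symm
  · exact congrArg Sum.inr (congrArg Prod.fst h)

theorem exists_homotopy {π : Z ⟶ B} (hπ : (MorphismProperty.monomorphisms SSet.{u}).rlp π)
    {f g : W ⟶ Z} (h : f ≫ π = g ≫ π) {x y : J _⦋0⦌} (hxy : x ≠ y) :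
    ∃ H : W ⊗ J ⟶ Z, atVertex W x ≫ H = f ∧ atVertex W y ≫ H = g := by
  have sq : CommSq (FunctorToTypes.coprod.desc f g)
      (FunctorToTypes.coprod.desc (atVertex W x) (atVertex W y)) π (fst W J ≫ f ≫ π) := by
    refine ⟨NatTrans.ext (funext fun n => ConcreteCategory.hom_ext _ _ ?_)⟩
    rintro (w | w)
    · rfl
    · exact (ConcreteCategory.congr_hom (NatTrans.congr_app h n) w).symm
  have := hπ _ (mono_desc_atVertex W hxy)
  exact ⟨sq.lift, congrArg (FunctorToTypes.coprod.inl ≫ ·) sq.fac_left,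
    congrArg (FunctorToTypes.coprod.inr ≫ ·) sq.fac_left⟩

theorem curry_app_eq_mapVertex (x : J _⦋0⦌) (H : W ⊗ J ⟶ Z) :
    (MonoidalClosed.curry H).app _ x = mapVertex (atVertex W x ≫ H) := by
  have h : W ◁ SSet.yonedaEquiv.symm x = fst W Δ[0] ≫ atVertex W x := by
    refine CartesianMonoidalCategory.hom_ext _ _ ?_ ?_
    · rw [whiskerLeft_fst, Category.assoc, atVertex, lift_fst, Category.comp_id]
    · rw [whiskerLeft_snd, Category.assoc, atVertex, lift_snd, SSet.yonedaEquiv_symm_zero]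
      rfl
  rw [mapVertex, ← Category.assoc, ← h, MonoidalClosed.curry_natural_left]
  rw [SSet.yonedaEquiv_comp, Equiv.apply_symm_apply]

theorem coherentIso_x₀_ne_x₁ : SSet.coherentIso.x₀.{u} ≠ SSet.coherentIso.x₁ := fun h =>
  Bool.false_ne_true
    (congrArg (fun F : SSet.coherentIso.{u} _⦋0⦌ => WalkingIso.equivBool (F.obj 0)) h)

theorem areIsomorphic_of_comp_eq {π : Z ⟶ B}
    (hπ : (MorphismProperty.monomorphisms SSet.{u}).rlp π) {f g : W ⟶ Z} (h : f ≫ π = g ≫ π) :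
    AreIsomorphic f g := by
  obtain ⟨H, rfl, rfl⟩ := exists_homotopy hπ h coherentIso_x₀_ne_x₁
  exact ⟨(SSet.coherentIso.hom.map (MonoidalClosed.curry H)).ofEq (curry_app_eq_mapVertex _ H)
    (curry_app_eq_mapVertex _ H), ⟨(SSet.coherentIso.invStructHom.map _).ofEq rfl⟩⟩

end

/-! ### The slice and the fiber as generalized slices -/

theorem part_zero_compl {X : SSet.{u}} (χ : X ⟶ Δ[1]) : part χ {0}ᶜ = fiberOver χ 1 :=
  congrArg (part χ) (by decide : ({0}ᶜ : Finset (Fin 2)) = {1})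

namespace Shape

/-- The shape of the slice: its generalized join is the join. -/
abbrev ofSlice : Shape := ⟨1, {0}, Finset.mem_singleton_self 0⟩

/-- The shape of the fiber of `C ^ (K^◁) ⟶ C ^ K`: its generalized join is the product with the
cone. -/
abbrev ofCone : Shape := ⟨1, Finset.univ, Finset.mem_univ 0⟩

/-- The morphism of shapes that forgets the map to the first variable over `1`. -/
def forgetOne : ofCone ⟶ ofSlice := ⟨𝟙 _, fun _ _ => Finset.mem_univ _, fun _ => Iff.rfl⟩

end Shape

section

variable (W K : SSet.{u})

/-- The join is the generalized join of shape `Shape.ofSlice`. -/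
def joinIso : join W K ≅ Shape.ofSlice.join W K where
  hom.app n := ↾fun (t : JoinData (SSet.stdSimplex.obj n.unop) W K) =>
    (⟨t.χ, t.left, SSet.Subcomplex.homOfLE (part_zero_compl t.χ).le ≫ t.right⟩ :
      PartsData ({0} : Finset (Fin 2)) {0}ᶜ (SSet.stdSimplex.obj n.unop) W K)
  inv.app n := ↾fun (t : PartsData ({0} : Finset (Fin 2)) {0}ᶜ (SSet.stdSimplex.obj n.unop) W K) =>
    (⟨t.χ, t.left, SSet.Subcomplex.homOfLE (part_zero_compl t.χ).ge ≫ t.right⟩ :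
      JoinData (SSet.stdSimplex.obj n.unop) W K)

theorem yonedaEquiv_symm_app_part {W : SSet.{u}} {n : SimplexCategory} {r : ℕ}
    {χ : SSet.stdSimplex.obj n ⟶ Δ[r]} {U : Finset (Fin (r + 1))}
    (l : (part χ U : SSet.{u}) ⟶ W) (h) {k} {y : (SSet.stdSimplex.obj n : SSet.{u}).obj k}
    (hy : y ∈ (part χ U).obj k) :
    (SSet.yonedaEquiv.symm (l.app (op n)
      ⟨SSet.yonedaEquiv (𝟙 (SSet.stdSimplex.obj n)), h⟩)).app k y = l.app k ⟨y, hy⟩ := by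
  refine (NatTrans.naturality_apply l (SSet.stdSimplex.objEquiv y).op
    ⟨SSet.yonedaEquiv (𝟙 (SSet.stdSimplex.obj n)), h⟩).symm.trans
      (congrArg (l.app k) (Subtype.ext ?_))
  exact vertexOf_ext fun i => rfl

/-- The map of `coneProductIso`. -/
def coneToParts : leftCone K ⊗ W ⟶ Shape.ofCone.join W K where
  app n := ↾fun x =>
    (⟨JoinData.χ (X := SSet.stdSimplex.obj n.unop) x.1,
      (part (JoinData.χ (X := SSet.stdSimplex.obj n.unop) x.1) Finset.univ).ι ≫
        SSet.yonedaEquiv.symm x.2,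
      SSet.Subcomplex.homOfLE (part_zero_compl _).le ≫
        JoinData.right (X := SSet.stdSimplex.obj n.unop) x.1⟩ :
      PartsData (Finset.univ : Finset (Fin 2)) {0}ᶜ (SSet.stdSimplex.obj n.unop) W K)
  naturality n m f := by
    refine ConcreteCategory.hom_ext _ _ fun x => ?_
    refine PartsData.ext_of_apply (X := SSet.stdSimplex.obj m.unop) rfl ?_ (fun _ _ _ _ => rfl)
    intro k y _ _
    exact (ConcreteCategory.congr_hom (NatTrans.congr_app
      (SSet.yonedaEquiv_symm_naturality_left f.unop x.2) k) y).symm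

/-- The inverse of `coneProductIso`. -/
def partsToCone : Shape.ofCone.join W K ⟶ leftCone K ⊗ W where
  app n := ↾fun (t : PartsData (Finset.univ : Finset (Fin 2)) {0}ᶜ
      (SSet.stdSimplex.obj n.unop) W K) =>
    ((⟨t.χ, SSet.stdSimplex.isTerminalObj₀.from _,
      SSet.Subcomplex.homOfLE (part_zero_compl t.χ).ge ≫ t.right⟩ :
        JoinData (SSet.stdSimplex.obj n.unop) Δ[0] K),
      t.left.app n ⟨SSet.yonedaEquiv (𝟙 (SSet.stdSimplex.obj n.unop)),
        (mem_part_iff _ _ _).2 fun _ => Finset.mem_univ _⟩)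
  naturality n m f := by
    refine ConcreteCategory.hom_ext (C := Type u) _ _ fun t => Prod.ext ?_ ?_
    · refine JoinData.ext_of_apply (X := SSet.stdSimplex.obj m.unop) rfl ?_ (fun _ _ _ _ => rfl)
      exact fun _ _ _ _ => vertexOf_ext (n := ⦋0⦌) fun _ => Subsingleton.elim (α := Fin 1) _ _
    · refine Eq.trans ?_ (NatTrans.naturality_apply
        (PartsData.left (X := SSet.stdSimplex.obj n.unop) t) f
        ⟨SSet.yonedaEquiv (𝟙 (SSet.stdSimplex.obj n.unop)),
          (mem_part_iff _ _ _).2 fun _ => Finset.mem_univ _⟩)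
      refine congrArg ((PartsData.left (X := SSet.stdSimplex.obj n.unop) t).app m) ?_
      exact Subtype.ext (SSet.yonedaEquiv_naturality f.unop
        (𝟙 (SSet.stdSimplex.obj n.unop))).symm

/-- The product with the cone is the generalized join of shape `Shape.ofCone`. -/
def coneProductIso : leftCone K ⊗ W ≅ Shape.ofCone.join W K where
  hom := coneToParts W K
  inv := partsToCone W K
  hom_inv_id := by
    refine NatTrans.ext (funext fun n => ConcreteCategory.hom_ext (C := Type u) _ _ fun x =>
      Prod.ext ?_ ?_)
    · refine JoinData.ext_of_apply (X := SSet.stdSimplex.obj n.unop) rfl ?_ (fun _ _ _ _ => rfl)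
      exact fun _ _ _ _ => vertexOf_ext (n := ⦋0⦌) fun _ => Subsingleton.elim (α := Fin 1) _ _
    · exact SSet.yonedaEquiv_symm_app_id x.2
  inv_hom_id := by
    refine NatTrans.ext (funext fun n => ConcreteCategory.hom_ext _ _ fun t => ?_)
    refine PartsData.ext_of_apply (X := SSet.stdSimplex.obj n.unop) rfl ?_ (fun _ _ _ _ => rfl)
    exact fun k y hy _ => yonedaEquiv_symm_app_part _ _ hy

variable {W} in
theorem mapLeft_coneProductIso_inv {V : SSet.{u}} (g : W ⟶ V) :
    mapLeft g K ≫ (coneProductIso V K).inv = (coneProductIso W K).inv ≫ leftCone K ◁ g := rfl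

variable {W} in
theorem whiskerLeft_coneProductIso_hom {V : SSet.{u}} (g : W ⟶ V) :
    leftCone K ◁ g ≫ (coneProductIso V K).hom = (coneProductIso W K).hom ≫ mapLeft g K := by
  rw [← Iso.inv_comp_eq, ← Category.assoc, ← mapLeft_coneProductIso_inv, Category.assoc,
    Iso.inv_hom_id, Category.comp_id]

theorem coneProductIso_inv_coneToJoin : (coneProductIso W K).inv ≫ coneToJoin W K =
    Shape.Hom.mapJoin Shape.forgetOne W K ≫ (joinIso W K).inv := by
  refine NatTrans.ext (funext fun n => ConcreteCategory.hom_ext _ _ fun t => ?_)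
  refine JoinData.ext_of_apply (X := SSet.stdSimplex.obj n.unop) ?_ ?_ ?_
  · refine Eq.trans ?_ ((congrArg (PartsData.χ (X := SSet.stdSimplex.obj n.unop) t ≫ ·)
      (SSet.stdSimplex.map_id ⦋1⦌)).trans (Category.comp_id _)).symm
    exact (SSet.yonedaEquiv_symm_comp _ _).trans (Equiv.symm_apply_apply _ _)
  · intro k y hy hy'
    exact yonedaEquiv_symm_app_part (PartsData.left (X := SSet.stdSimplex.obj n.unop) t) _ _
  · intro k y hy hy'
    refine congrArg ((PartsData.right (X := SSet.stdSimplex.obj n.unop) t).app k) ?_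
    exact Subtype.ext (vertexOf_ext fun i => rfl)

end

section

variable {W K C : SSet.{u}} {p : K ⟶ C}

theorem vertexOf_joinInr_mem {n : SimplexCategoryᵒᵖ} (x : K.obj n) (i) :
    vertexOf (SSet.yonedaEquiv (JoinData.χ (X := SSet.stdSimplex.obj n.unop)
      ((joinInr W K).app n x))) i ∈ ({0}ᶜ : Finset (Fin 2)) :=
  (by decide : (1 : Fin 2) ∈ ({0}ᶜ : Finset (Fin 2)))

theorem joinInr_app_right {n : SimplexCategoryᵒᵖ}
    (t : JoinData (SSet.stdSimplex.obj n.unop) W K)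
    (ht : ∀ i, vertexOf (SSet.yonedaEquiv t.χ) i ∈ ({0}ᶜ : Finset (Fin 2))) (h) :
    (joinInr W K).app n (t.right.app n ⟨SSet.yonedaEquiv (𝟙 (SSet.stdSimplex.obj n.unop)), h⟩) =
      t := by
  have eq_one (i) : vertexOf (SSet.yonedaEquiv t.χ) i = 1 :=
    Fin.eq_one_of_ne_zero _ (by simpa only [Finset.mem_compl, Finset.mem_singleton] using ht i)
  refine JoinData.ext_of_apply (X := SSet.stdSimplex.obj n.unop) ?_ ?_ ?_
  · exact SSet.yonedaEquiv.injective (vertexOf_ext (n := ⦋1⦌) fun i => (eq_one i).symm)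
  · exact fun k x hx _ => (isEmpty_fiberOver_zero _ k ⟨x, hx⟩).elim
  · exact fun k y _ hy => yonedaEquiv_symm_app_part t.right _ _

theorem restrictsTo_joinIso_inv_comp_iff {f : join W K ⟶ C} :
    Shape.ofSlice.RestrictsTo p ((joinIso W K).inv ≫ f) ↔ joinInr W K ≫ f = p := by
  constructor
  · intro h
    refine NatTrans.ext (funext fun n => ConcreteCategory.hom_ext _ _ fun x => ?_)
    refine (h.apply ((joinIso W K).hom.app n ((joinInr W K).app n x))
      (vertexOf_joinInr_mem x)).trans ?_
    exact congrArg (p.app n) (SSet.yonedaEquiv_symm_app_id x)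
  · rintro rfl
    refine NatTrans.ext (funext fun n => ConcreteCategory.hom_ext _ _ fun t => ?_)
    refine congrArg (f.app n) ?_
    exact (joinInr_app_right ((joinIso W K).inv.app n t.1) t.2
      ((part_zero_compl _).le _ ((mem_part_iff _ _ _).2 fun i => t.2 i))).symm

theorem restrictsTo_coneProductIso_inv_comp_iff {f : leftCone K ⊗ W ⟶ C} :
    Shape.ofCone.RestrictsTo p ((coneProductIso W K).inv ≫ f) ↔
      joinInr Δ[0] K ▷ W ≫ f = fst K W ≫ p := by
  constructor
  · intro h
    refine NatTrans.ext (funext fun n => ConcreteCategory.hom_ext _ _ fun x => ?_)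
    have h_apply := h.apply ((joinInr Δ[0] K ▷ W ≫ (coneProductIso W K).hom).app n x)
      (vertexOf_joinInr_mem (W := Δ[0]) x.1)
    have inv_hom := ConcreteCategory.congr_hom (NatTrans.congr_app
      (coneProductIso W K).hom_inv_id n) ((joinInr Δ[0] K ▷ W).app n x)
    refine (congrArg (f.app n) inv_hom).symm.trans (h_apply.trans ?_)
    exact congrArg (p.app n) (SSet.yonedaEquiv_symm_app_id x.1)
  · intro h
    refine NatTrans.ext (funext fun n => ConcreteCategory.hom_ext _ _ fun t => ?_)
    let x : (K ⊗ W).obj n := show K.obj n × W.obj n from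
      ((Shape.ofCone.awayProj K W).app n t, ((coneProductIso W K).inv.app n t.1).2)
    have inv_eq : (coneProductIso W K).inv.app n t.1 = (joinInr Δ[0] K ▷ W).app n x :=
      Prod.ext (joinInr_app_right ((coneProductIso W K).inv.app n t.1).1 t.2
        ((part_zero_compl _).le _ ((mem_part_iff _ _ _).2 fun i => t.2 i))).symm rfl
    have h_apply := ConcreteCategory.congr_hom (NatTrans.congr_app h n) x
    exact (congrArg (f.app n) inv_eq).trans h_apply

/-- The slice is the generalized slice of shape `Shape.ofSlice`. -/
def sliceIso (p : K ⟶ C) : slice p ≅ Shape.ofSlice.slice p where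
  hom.app n := ↾fun f =>
    { base := SSet.yonedaEquiv (SSet.stdSimplex.isTerminalObj₀.from (SSet.stdSimplex.obj n.unop))
      hom := (joinIso _ K).inv ≫ f.1
      comm := restrictsTo_joinIso_inv_comp_iff.2 f.2 }
  hom.naturality n m f := by
    refine ConcreteCategory.hom_ext _ _ fun x => StableFamily.RelMap.ext ?_ rfl
    exact vertexOf_ext (n := ⦋0⦌) fun _ => Subsingleton.elim (α := Fin 1) _ _
  inv.app n := ↾fun (f : (Shape.ofSlice.awayFamily K).RelMap _ n.unop) =>
    ⟨(joinIso _ K).hom ≫ f.hom, restrictsTo_joinIso_inv_comp_iff.1 f.comm⟩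
  inv_hom_id := by
    refine NatTrans.ext (funext fun n => ConcreteCategory.hom_ext _ _ fun x => ?_)
    refine StableFamily.RelMap.ext ?_ rfl
    exact vertexOf_ext (n := ⦋0⦌) fun _ => Subsingleton.elim (α := Fin 1) _ _

theorem from_mapVertex (p : K ⟶ C) (W : SSet.{u}) :
    SSet.stdSimplex.isTerminalObj₀.from W ≫ SSet.yonedaEquiv.symm (mapVertex p) =
      MonoidalClosed.curry (fst K W ≫ p) := by
  rw [mapVertex, Equiv.symm_apply_apply, ← MonoidalClosed.curry_natural_left,
    whiskerLeft_fst_assoc]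

/-- The map to the fiber of `C ^ (K^◁) ⟶ C ^ K` corresponding to a map from a product. -/
def toConeFiber (f : leftCone K ⊗ W ⟶ C) (hf : joinInr Δ[0] K ▷ W ≫ f = fst K W ≫ p) :
    W ⟶ coneFiber p :=
  pullback.lift (MonoidalClosed.curry f) (SSet.stdSimplex.isTerminalObj₀.from W) (by
    rw [from_mapVertex, MonoidalClosed.curry_pre_app, hf])

/-- The map from a product corresponding to a map to the fiber of `C ^ (K^◁) ⟶ C ^ K`. -/
def ofConeFiber (ρ : W ⟶ coneFiber p) : leftCone K ⊗ W ⟶ C :=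
  MonoidalClosed.uncurry (ρ ≫ pullback.fst _ _)

theorem ofConeFiber_toConeFiber (f : leftCone K ⊗ W ⟶ C)
    (hf : joinInr Δ[0] K ▷ W ≫ f = fst K W ≫ p) : ofConeFiber (toConeFiber f hf) = f := by
  rw [ofConeFiber, toConeFiber, pullback.lift_fst, MonoidalClosed.uncurry_curry]

theorem ofConeFiber_comp {V : SSet.{u}} (g : V ⟶ W) (ρ : W ⟶ coneFiber p) :
    ofConeFiber (g ≫ ρ) = leftCone K ◁ g ≫ ofConeFiber ρ := by
  rw [ofConeFiber, Category.assoc, MonoidalClosed.uncurry_natural_left, ofConeFiber]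

theorem ofConeFiber_injective {ρ ρ' : W ⟶ coneFiber p} (h : ofConeFiber ρ = ofConeFiber ρ') :
    ρ = ρ' :=
  pullback.hom_ext (MonoidalClosed.uncurry_injective h)
    (SSet.stdSimplex.isTerminalObj₀.hom_ext _ _)

theorem joinInr_ofConeFiber (ρ : W ⟶ coneFiber p) :
    joinInr Δ[0] K ▷ W ≫ ofConeFiber ρ = fst K W ≫ p := by
  refine MonoidalClosed.curry_injective ?_
  rw [← MonoidalClosed.curry_pre_app, ofConeFiber, MonoidalClosed.curry_uncurry, Category.assoc,
    pullback.condition, ← from_mapVertex, ← Category.assoc]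
  exact congrArg (· ≫ _) (SSet.stdSimplex.isTerminalObj₀.hom_ext _ _)

/-- The map of `coneFiberIso`. -/
def coneFiberToParts (p : K ⟶ C) : coneFiber p ⟶ Shape.ofCone.slice p :=
  Shape.curry (restrictsTo_coneProductIso_inv_comp_iff.2 (joinInr_ofConeFiber (𝟙 (coneFiber p))))

theorem joinInr_coneProductIso_hom_uncurry (ρ : W ⟶ Shape.ofCone.slice p) :
    joinInr Δ[0] K ▷ W ≫ (coneProductIso W K).hom ≫ Shape.uncurry ρ = fst K W ≫ p := by
  rw [← restrictsTo_coneProductIso_inv_comp_iff, Iso.inv_hom_id_assoc]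
  exact Shape.restrictsTo_uncurry ρ

/-- The inverse of `coneFiberIso`. -/
def partsToConeFiber (p : K ⟶ C) : Shape.ofCone.slice p ⟶ coneFiber p :=
  toConeFiber _ (joinInr_coneProductIso_hom_uncurry (𝟙 (Shape.ofCone.slice p)))

theorem uncurry_comp_coneFiberToParts (ρ : W ⟶ coneFiber p) :
    Shape.uncurry (ρ ≫ coneFiberToParts p) = (coneProductIso W K).inv ≫ ofConeFiber ρ := by
  rw [Shape.uncurry_comp, coneFiberToParts, Shape.uncurry_curry, ← Category.assoc,
    mapLeft_coneProductIso_inv, Category.assoc, ← ofConeFiber_comp, Category.comp_id]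

theorem ofConeFiber_comp_partsToConeFiber (ρ : W ⟶ Shape.ofCone.slice p) :
    ofConeFiber (ρ ≫ partsToConeFiber p) = (coneProductIso W K).hom ≫ Shape.uncurry ρ := by
  rw [ofConeFiber_comp, partsToConeFiber, ofConeFiber_toConeFiber, ← Category.assoc,
    whiskerLeft_coneProductIso_hom, Category.assoc, ← Shape.uncurry_comp, Category.comp_id]

/-- The fiber of `C ^ (K^◁) ⟶ C ^ K` is the generalized slice of shape `Shape.ofCone`. -/
def coneFiberIso (p : K ⟶ C) : coneFiber p ≅ Shape.ofCone.slice p where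
  hom := coneFiberToParts p
  inv := partsToConeFiber p
  hom_inv_id := ofConeFiber_injective (by
    rw [ofConeFiber_comp_partsToConeFiber, ← Category.id_comp (coneFiberToParts p),
      uncurry_comp_coneFiberToParts, Iso.hom_inv_id_assoc])
  inv_hom_id := Shape.uncurry_injective (by
    rw [uncurry_comp_coneFiberToParts, ← Category.id_comp (partsToConeFiber p),
      ofConeFiber_comp_partsToConeFiber, Iso.inv_hom_id_assoc])

theorem ofConeFiber_comp_sliceComparison {n : SimplexCategory}
    (x : SSet.stdSimplex.obj n ⟶ slice p) : ofConeFiber (x ≫ sliceComparison p) =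
      coneToJoin (SSet.stdSimplex.obj n) K ≫ Subtype.val (SSet.yonedaEquiv x) := by
  have comp_sliceToCone : x ≫ sliceToCone p = MonoidalClosed.curry
      (coneToJoin (SSet.stdSimplex.obj n) K ≫ Subtype.val (SSet.yonedaEquiv x)) :=
    SSet.yonedaEquiv.injective (SSet.yonedaEquiv_comp x (sliceToCone p))
  rw [ofConeFiber, Category.assoc, sliceComparison, pullback.lift_fst, comp_sliceToCone,
    MonoidalClosed.uncurry_curry]

theorem sliceComparison_coneFiberIso_hom (p : K ⟶ C) :
    sliceComparison p ≫ (coneFiberIso p).hom =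
      (sliceIso p).hom ≫ Shape.Hom.res p Shape.forgetOne := by
  refine Shape.uncurry_injective ((Shape.restrictsTo_uncurry _).hom_ext
    (Shape.restrictsTo_uncurry _) fun {n} x => ?_)
  have uncurry_sliceIso : mapLeft x K ≫ Shape.uncurry (sliceIso p).hom =
      (joinIso _ K).inv ≫ Subtype.val (SSet.yonedaEquiv x) := Shape.mapLeft_uncurry _ x
  calc mapLeft x K ≫ Shape.uncurry (sliceComparison p ≫ (coneFiberIso p).hom)
    _ = (coneProductIso _ K).inv ≫ ofConeFiber (x ≫ sliceComparison p) := by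
      rw [← Shape.uncurry_comp, ← Category.assoc]
      exact uncurry_comp_coneFiberToParts _
    _ = Shape.Hom.mapJoin Shape.forgetOne _ K ≫ mapLeft x K ≫ Shape.uncurry (sliceIso p).hom := by
      rw [ofConeFiber_comp_sliceComparison, uncurry_sliceIso, ← Category.assoc,
        coneProductIso_inv_coneToJoin, Category.assoc]
    _ = mapLeft x K ≫ Shape.uncurry ((sliceIso p).hom ≫ Shape.Hom.res p Shape.forgetOne) := by
      rw [← Shape.uncurry_comp, ← Shape.Hom.uncurry_comp_res, Category.assoc, Shape.uncurry_comp]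

end

section

variable {K C : SSet.{u}}

theorem joinInr_injective (W : SSet.{u}) (n) : Function.Injective ((joinInr W K).app n) := by
  intro x y h
  let rightPart (t : {t : JoinData (SSet.stdSimplex.obj n.unop) W K //
      SSet.yonedaEquiv (𝟙 (SSet.stdSimplex.obj n.unop)) ∈ (fiberOver t.χ 1).obj n}) : K.obj n :=
    t.1.right.app n ⟨_, t.2⟩
  have rightPart_joinInr (x : K.obj n) : rightPart ⟨(joinInr W K).app n x,
      (SSet.stdSimplex.mem_face_iff (n := 1) (d := n.unop.len) _ _).2
        fun _ => Finset.mem_singleton.2 rfl⟩ = x :=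
    SSet.yonedaEquiv_symm_app_id x
  exact (rightPart_joinInr x).symm.trans
    ((congrArg rightPart (Subtype.ext h)).trans (rightPart_joinInr y))

instance (W : SSet.{u}) : Mono (joinInr W K) := by
  have mono_app (n) : Mono ((joinInr W K).app n) :=
    (mono_iff_injective _).2 (joinInr_injective W n)
  exact NatTrans.mono_of_mono_app _

instance [SSet.Quasicategory C] (p : K ⟶ C) : SSet.Quasicategory (coneFiber p) := by
  rw [SSet.quasicategory_iff_of_isTerminal (pullback.snd (restrictCone K C) _)
    SSet.stdSimplex.isTerminalObj₀, SSet.innerFibration_iff]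
  exact MorphismProperty.pullback_snd _ _ (SSet.mem_innerFibrations (restrictCone K C))

theorem quasicategory_of_rlp {X Y : SSet.{u}} [SSet.Quasicategory Y] {π : X ⟶ Y}
    (hπ : (MorphismProperty.monomorphisms SSet.{u}).rlp π) : SSet.Quasicategory X := by
  have : SSet.InnerFibration π := ⟨fun _ _ i hi =>
    hπ i (SSet.innerHornInclusions_le_monomorphisms _ hi)⟩
  exact SSet.quasicategory_of_innerFibration π

theorem quasicategory_of_retract {X Y : SSet.{u}} [SSet.Quasicategory Y] {i : X ⟶ Y} {r : Y ⟶ X}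
    (h : i ≫ r = 𝟙 X) : SSet.Quasicategory X where
  hornFilling' n k σ h0 hn := by
    obtain ⟨τ, hτ⟩ := SSet.Quasicategory.hornFilling h0 hn (σ ≫ i)
    refine ⟨τ ≫ r, ?_⟩
    rw [← Category.assoc, ← hτ, Category.assoc, h, Category.comp_id]

theorem exists_section {X Y : SSet.{u}} {π : X ⟶ Y}
    (hπ : (MorphismProperty.monomorphisms SSet.{u}).rlp π) : ∃ s : Y ⟶ X, s ≫ π = 𝟙 Y := by
  have sq : CommSq (initial.to X) (initial.to Y) π (𝟙 Y) := ⟨initialIsInitial.hom_ext _ _⟩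
  have := hπ (initial.to Y) (inferInstanceAs (Mono (initial.to Y)))
  exact ⟨sq.lift, sq.fac_right⟩

theorem IsInftyEquivalence.of_iso {X Y X' Y' : SSet.{u}} {φ : X ⟶ Y} {φ' : X' ⟶ Y'}
    (a : X ≅ X') (b : Y ≅ Y') (h : φ ≫ b.hom = a.hom ≫ φ') (hφ : IsInftyEquivalence φ') :
    IsInftyEquivalence φ := by
  obtain ⟨ψ, left_inv, right_inv⟩ := hφ
  have inv_comp : a.inv ≫ φ = φ' ≫ b.inv := by
    rw [Iso.inv_comp_eq, ← Category.assoc, ← h, Category.assoc, b.hom_inv_id, Category.comp_id]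
  refine ⟨b.hom ≫ ψ ≫ a.inv, ?_, ?_⟩
  · have := (left_inv.comp_left a.hom).comp_right a.inv
    rwa [Category.comp_id, a.hom_inv_id, ← Category.assoc, ← h, Category.assoc,
      Category.assoc] at this
  · have := (right_inv.comp_left b.hom).comp_right b.inv
    rw [Category.comp_id, b.hom_inv_id] at this
    rwa [Category.assoc, Category.assoc, inv_comp, ← Category.assoc ψ, ← Category.assoc]

end

/-! ### The zigzag of trivial fibrations -/

namespace Shape

/-- The shape over `Δ[2]` whose restriction to the edge `0 ⟶ 1` is `ofCone` and whose restriction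
to the edge `0 ⟶ 2` is `ofSlice`. -/
abbrev ofInterpolation : Shape := ⟨2, {0, 1}, Finset.mem_insert_self 0 {1}⟩

/-- The shape over `Δ[2]` whose restrictions to the edges `0 ⟶ 1` and `0 ⟶ 2` are both `ofCone`. -/
abbrev ofDoubleCone : Shape := ⟨2, Finset.univ, Finset.mem_univ 0⟩

variable {D E : Shape}

/-- The morphism of shapes with a given map on vertices. -/
def homOfVertices (f : Fin (D.dim + 1) →o Fin (E.dim + 1))
    (mem_carrier : ∀ i, f i ∈ E.carrier → i ∈ D.carrier)
    (eq_zero_iff : ∀ i, f i = 0 ↔ i = 0) : D ⟶ E where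
  hom := SimplexCategory.mkHom f
  mem_carrier := mem_carrier
  mem_zero_compl i := by
    simp only [Finset.mem_compl, Finset.mem_singleton]
    exact not_congr (eq_zero_iff i)

/-- The edge `0 ⟶ 1` of `ofInterpolation`. -/
def interpolationStart : ofCone ⟶ ofInterpolation :=
  homOfVertices ⟨![0, 1], by decide⟩ (by decide) (by decide)

/-- The edge `0 ⟶ 2` of `ofInterpolation`. -/
def interpolationEnd : ofSlice ⟶ ofInterpolation :=
  homOfVertices ⟨![0, 2], by decide⟩ (by decide) (by decide)

/-- The degeneracy `Δ[2] ⟶ Δ[1]` as a morphism from `ofInterpolation`. -/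
def interpolationCollapse : ofInterpolation ⟶ ofSlice :=
  homOfVertices ⟨![0, 1, 1], by decide⟩ (by decide) (by decide)

/-- The edge `0 ⟶ 1` of `ofDoubleCone`. -/
def doubleConeStart : ofCone ⟶ ofDoubleCone :=
  homOfVertices ⟨![0, 1], by decide⟩ (by decide) (by decide)

/-- The edge `0 ⟶ 2` of `ofDoubleCone`. -/
def doubleConeEnd : ofCone ⟶ ofDoubleCone :=
  homOfVertices ⟨![0, 2], by decide⟩ (by decide) (by decide)

/-- The degeneracy `Δ[2] ⟶ Δ[1]` as a morphism from `ofDoubleCone`. -/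
def doubleConeCollapse : ofDoubleCone ⟶ ofCone :=
  homOfVertices ⟨![0, 1, 1], by decide⟩ (by decide) (by decide)

/-- The morphism of shapes that forgets the map to the first variable over `2`. -/
def forgetTwo : ofDoubleCone ⟶ ofInterpolation :=
  ⟨𝟙 _, fun _ _ => Finset.mem_univ _, fun _ => Iff.rfl⟩

theorem interpolationStart_collapse :
    interpolationStart ≫ interpolationCollapse = forgetOne := by
  ext i; revert i; decide

theorem interpolationEnd_collapse : interpolationEnd ≫ interpolationCollapse = 𝟙 ofSlice := by
  ext i; revert i; decide

theorem doubleConeStart_collapse : doubleConeStart ≫ doubleConeCollapse = 𝟙 ofCone := by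
  ext i; revert i; decide

theorem doubleConeEnd_collapse : doubleConeEnd ≫ doubleConeCollapse = 𝟙 ofCone := by
  ext i; revert i; decide

theorem doubleConeStart_forgetTwo : doubleConeStart ≫ forgetTwo = interpolationStart := by
  ext i; revert i; decide

theorem doubleConeEnd_forgetTwo :
    doubleConeEnd ≫ forgetTwo = forgetOne ≫ interpolationEnd := by
  ext i; revert i; decide

end Shape

open Shape Shape.Hom

variable {K C : SSet.{u}} [SSet.Quasicategory C] (p : K ⟶ C)

theorem res_interpolationStart_mem_rlp :
    (MorphismProperty.monomorphisms SSet.{u}).rlp (res p interpolationStart) :=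
  res_mem_rlp_monomorphisms _ (by decide) (by decide) p

theorem res_doubleConeStart_mem_rlp :
    (MorphismProperty.monomorphisms SSet.{u}).rlp (res p doubleConeStart) :=
  res_mem_rlp_monomorphisms _ (by decide) (by decide) p

theorem quasicategory_slice_ofSlice : SSet.Quasicategory (ofSlice.slice p) := by
  have : SSet.Quasicategory (ofCone.slice p) :=
    quasicategory_of_retract (coneFiberIso p).inv_hom_id
  have : SSet.Quasicategory (ofInterpolation.slice p) :=
    quasicategory_of_rlp (res_interpolationStart_mem_rlp p)
  exact quasicategory_of_retract (i := res p interpolationCollapse) (r := res p interpolationEnd)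
    (by rw [← res_comp, interpolationEnd_collapse, res_id])

/-- Both edges of the double cone have the common section `doubleConeCollapse`, and the first one
is a trivial fibration. -/
theorem areIsomorphic_res_doubleCone :
    AreIsomorphic (res p doubleConeEnd) (res p doubleConeStart) := by
  have collapse_start : res p doubleConeCollapse ≫ res p doubleConeStart = 𝟙 _ := by
    rw [← res_comp, doubleConeStart_collapse, res_id]
  have collapse_end : res p doubleConeCollapse ≫ res p doubleConeEnd = 𝟙 _ := by
    rw [← res_comp, doubleConeEnd_collapse, res_id]
  have retraction : AreIsomorphic (𝟙 _) (res p doubleConeStart ≫ res p doubleConeCollapse) :=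
    areIsomorphic_of_comp_eq (res_doubleConeStart_mem_rlp p)
      (by rw [Category.assoc, collapse_start, Category.comp_id, Category.id_comp])
  simpa only [Category.assoc, collapse_end, Category.comp_id, Category.id_comp] using
    retraction.comp_right (res p doubleConeEnd)

theorem areIsomorphic_res_interpolation :
    AreIsomorphic (res p interpolationEnd ≫ res p forgetOne) (res p interpolationStart) := by
  rw [← res_comp, ← doubleConeEnd_forgetTwo, ← doubleConeStart_forgetTwo, res_comp, res_comp]
  exact (areIsomorphic_res_doubleCone p).comp_left (res p forgetTwo)

theorem isInftyEquivalence_res_forgetOne : IsInftyEquivalence (res p forgetOne) := by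
  obtain ⟨s, s_start⟩ := exists_section (res_interpolationStart_mem_rlp p)
  have collapse_start : res p interpolationCollapse ≫ res p interpolationStart =
      res p forgetOne := by rw [← res_comp, interpolationStart_collapse]
  have collapse_end : res p interpolationCollapse ≫ res p interpolationEnd = 𝟙 _ := by
    rw [← res_comp, interpolationEnd_collapse, res_id]
  refine ⟨s ≫ res p interpolationEnd, ?_, ?_⟩
  · have lifts_isomorphic :
        AreIsomorphic (res p forgetOne ≫ s) (res p interpolationCollapse) :=
      areIsomorphic_of_comp_eq (res_interpolationStart_mem_rlp p)
        (by rw [Category.assoc, s_start, collapse_start, Category.comp_id])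
    simpa only [Category.assoc, collapse_end] using
      lifts_isomorphic.comp_right (res p interpolationEnd)
  · simpa only [Category.assoc, s_start] using (areIsomorphic_res_interpolation p).comp_left s

end InftySlice

end

theorem mainTheorem6 {K C : SSet.{u}} [SSet.Quasicategory C] (p : K ⟶ C) :
    SSet.Quasicategory (InftySlice.slice p) ∧
      SSet.Quasicategory (InftySlice.coneFiber p) ∧
        InftySlice.IsInftyEquivalence (InftySlice.sliceComparison p) := by
  have := InftySlice.quasicategory_slice_ofSlice p
  exact ⟨InftySlice.quasicategory_of_retract (InftySlice.sliceIso p).hom_inv_id, inferInstance,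
    (InftySlice.isInftyEquivalence_res_forgetOne p).of_iso (InftySlice.sliceIso p)
      (InftySlice.coneFiberIso p) (InftySlice.sliceComparison_coneFiberIso_hom p)⟩
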